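/- Let $N\ge 2$ and $\alpha=(\alpha_1,\dots,\alpha_{N+1})\in(0,\infty)^{N+1}$. Write $|x|_1=\sum_{i=1}^N|x_i|$ and $\Delta=\{x\in[0,1]^N:\ \sum_{i=1}^N x_i\le 1\}$, and let $\mu$ be the Dirichlet distribution on $\Delta$, that is, the probability measure with Lebesgue density $$\frac{\Gamma(\alpha_1+\dots+\alpha_{N+1})}{\prod_{i=1}^{N+1}\Gamma(\alpha_i)}\,(1-|x|_1)^{\alpha_{N+1}-1}\prod_{i=1}^N x_i^{\alpha_i-1},\qquad x\in\Delta .$$ Consider the stochastic differential equation on $\Delta$ $$dX_i(t)=\{\alpha_i(1-|X(t)|_1)-\alpha_{N+1}X_i(t)\}\,dt+\sqrt{2(1-|X(t)|_1)X_i(t)}\,dB_i(t),\qquad 1\le i\le N,$$ with $B$ an $N$-dimensional Brownian motion. Solutions are understood in the weak sense, as solutions of the martingale problem: $X$ is a continuous adapted $\Delta$-valued process such that $f(X(t))-\int_0^t Lf(X(s))\,ds$ is a martingale for every $f\in C^2(\mathbb R^N)$, where $$Lf(x)=\sum_{n=1}^N\Big(x_n(1-|x|_1)\,\partial_n^2f(x)+\{\alpha_n(1-|x|_1)-\alpha_{N+1}x_n\}\,\partial_nf(x)\Big).$$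 Let $(P_t)_{t\ge0}$ be the associated family of transition kernels, so that $P_tf(x)=\int f(y)\,P_t(x,dy)$, where $P_t(x,\cdot)$ is the law of $X(t)$ for a solution started from $x$. For $f,g\in C^2(\mathbb R^N)$ put $$\mathcal E(f,g)=\int_\Delta(1-|x|_1)\sum_{n=1}^N x_n\,\partial_nf(x)\,\partial_ng(x)\,\mu(dx).$$ Then the following hold. 1. $\int_\Delta fLg\,d\mu=\int_\Delta gLf\,d\mu$ and $-\int_\Delta fLg\,d\mu=\mathcal E(f,g)$ for all $f,g\in C^2(\mathbb R^N)$, and $\mathcal E$ is closable in $L^2(\mu)$. Denote its closure by $(\mathcal E,\mathcal D(\mathcal E))$. 2. Every $P_t$ acts on $L^2(\mu)$ and is symmetric there: $\int f\,P_tg\,d\mu=\int g\,P_tf\,d\mu$ for all $f,g\in L^2(\mu)$. The generator of $(P_t)$ in $L^2(\mu)$ is the $L^2(\mu)$-closure of $L$ on $C^2(\mathbb R^N)$ (restricted to $\Delta$). 3. The spectral gap of the generator is $\alpha_{N+1}$: $$\inf\{\mathcal E(f,f):\ f\in\mathcal D(\mathcal E),\ \mu(f)=0,\ \mu(f^2)=1\}=\alpha_{N+1}.$$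 4. $\|P_tf-\mu(f)\|_{L^2(\mu)}\le e^{-\alpha_{N+1}t}\|f\|_{L^2(\mu)}$ for all $t\ge0$ and $f\in L^2(\mu)$; that is, $\|P_t-\mu\|_{L^2(\mu)}\le e^{-\alpha_{N+1}t}$ in operator norm. 5. $\mu(f^2)\le\frac1{\alpha_{N+1}}\mathcal E(f,f)$ for all $f\in\mathcal D(\mathcal E)$ with $\mu(f)=0$, and $\frac1{\alpha_{N+1}}$ is the smallest constant for which this inequality holds. -/

import Mathlib

open MeasureTheory ProbabilityTheory Filter Topology
open scoped NNReal ENNReal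

noncomputable section

namespace DirichletDiffusion

/-- The set `Δ^(N)` of all `x ∈ [0,1]^N` with `∑ x_i ≤ 1`. -/
def simplexSet (N : ℕ) : Set (Fin N → ℝ) :=
  {x | (∀ i, x i ∈ Set.Icc (0 : ℝ) 1) ∧ ∑ i, x i ≤ 1}

/-- `Δ^(N)` as a type; it carries the subspace topology and its Borel σ-algebra. -/
abbrev Simplex (N : ℕ) : Type := simplexSet N

/-- `1 - |x|₁`, where `|x|₁ = ∑ |x_i|`. -/
def rest {N : ℕ} (x : Fin N → ℝ) : ℝ := 1 - ∑ i, |x i|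

/-- The Dirichlet density. The parameters `α₁, …, α_N, α_{N+1}` are
`α (Fin.castSucc i)` for `i : Fin N`, and `α (Fin.last N)`. -/
def dirichletDensity {N : ℕ} (α : Fin (N + 1) → ℝ) (x : Fin N → ℝ) : ℝ :=
  Real.Gamma (∑ i, α i) / (∏ i, Real.Gamma (α i)) *
    rest x ^ (α (Fin.last N) - 1) * ∏ i, x i ^ (α i.castSucc - 1)

/-- The Dirichlet distribution on `Δ^(N)`: the measure with the Dirichlet density with respect to
`N`-dimensional Lebesgue measure on `Δ^(N)`. -/
def dirichletMeasure {N : ℕ} (α : Fin (N + 1) → ℝ) : Measure (Simplex N) :=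
  (Measure.comap (Subtype.val : Simplex N → Fin N → ℝ) volume).withDensity fun x => ENNReal.ofReal (dirichletDensity α x)

/-- The partial derivative `∂_n f`. -/
def pderiv {N : ℕ} (n : Fin N) (f : (Fin N → ℝ) → ℝ) (x : Fin N → ℝ) : ℝ :=
  fderiv ℝ f x (Pi.single n 1)

/-- The drift of the `n`-th coordinate in
`dX_n = {α_n (1 - |X|₁) - α_{N+1} X_n} dt + √(2 (1 - |X|₁) X_n) dB_n`. -/
def drift {N : ℕ} (α : Fin (N + 1) → ℝ) (n : Fin N) (x : Fin N → ℝ) : ℝ :=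
  α n.castSucc * rest x - α (Fin.last N) * x n

/-- The diffusion coefficient of the `n`-th coordinate in the same equation. -/
def diffusionCoeff {N : ℕ} (n : Fin N) (x : Fin N → ℝ) : ℝ :=
  Real.sqrt (2 * rest x * x n)

/-- The second-order differential operator
`L f = ∑ n, (x_n (1 - |x|₁) ∂_n² f + {α_n (1 - |x|₁) - α_{N+1} x_n} ∂_n f)`. -/
def diffOp {N : ℕ} (α : Fin (N + 1) → ℝ) (f : (Fin N → ℝ) → ℝ) (x : Fin N → ℝ) : ℝ :=
  ∑ n, (x n * rest x * pderiv n (pderiv n f) x + drift α n x * pderiv n f x)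

/-- On `Δ^(N)`, the operator `L` is the one attached to the coefficients of the equation:
`L f = ∑ n, (½ σ_n² ∂_n² f + b_n ∂_n f)`. -/
theorem diffOp_eq {N : ℕ} (α : Fin (N + 1) → ℝ) (f : (Fin N → ℝ) → ℝ) (x : Simplex N) :
    diffOp α f x = ∑ n, (1 / 2 * diffusionCoeff n x ^ 2 * pderiv n (pderiv n f) x
      + drift α n x * pderiv n f x) := by
  obtain ⟨x, h01, hsum⟩ := x
  have habs : ∑ i, |x i| = ∑ i, x i :=
    Finset.sum_congr rfl fun i _ => abs_of_nonneg (h01 i).1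
  refine Finset.sum_congr rfl fun n _ => ?_
  have hr : 0 ≤ rest x := by unfold rest; rw [habs]; linarith
  have h : 0 ≤ 2 * rest x * x n := mul_nonneg (mul_nonneg zero_le_two hr) (h01 n).1
  simp only [diffusionCoeff, Real.sq_sqrt h]
  ring

/-- `X` is a weak solution, on `Δ^(N)` and started from `x`, of
`dX_n = {α_n (1 - |X|₁) - α_{N+1} X_n} dt + √(2 (1 - |X|₁) X_n) dB_n`, `1 ≤ n ≤ N`,
in the martingale-problem formulation of Stroock and Varadhan: `X` is adapted to some filtration,
has continuous paths, starts from `x`, and `f(X_t) - ∫₀ᵗ L f(X_s) ds` is a martingale for every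
`f` of class `C²`. -/
structure IsWeakSolution {N : ℕ} (α : Fin (N + 1) → ℝ) (x : Simplex N)
    {Ω : Type} [mΩ : MeasurableSpace Ω] (P : Measure Ω) (X : ℝ≥0 → Ω → Simplex N) : Prop where
  isProbabilityMeasure : IsProbabilityMeasure P
  continuous_paths : ∀ ω, Continuous fun t => X t ω
  start : ∀ᵐ ω ∂P, X 0 ω = x
  martingale : ∃ ℱ : Filtration ℝ≥0 mΩ, (∀ t, Measurable[ℱ t] (X t)) ∧
    ∀ f : (Fin N → ℝ) → ℝ, ContDiff ℝ 2 f →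
      Martingale (fun t ω => f (X t ω) - ∫ s in (0 : ℝ)..t, diffOp α f (X s.toNNReal ω)) ℱ P

/-- `(P_t)` is the family of transition kernels of the diffusion: for every `x`, the measures
`P_t(x, ·)`, `t ≥ 0`, are the one-dimensional laws of a solution started from `x`. -/
def IsDiffusionSemigroup {N : ℕ} (α : Fin (N + 1) → ℝ)
    (κ : ℝ≥0 → Kernel (Simplex N) (Simplex N)) : Prop :=
  ∀ x, ∃ (Ω : Type) (_mΩ : MeasurableSpace Ω) (P : Measure Ω) (X : ℝ≥0 → Ω → Simplex N),
    IsWeakSolution α x P X ∧ ∀ t, κ t x = P.map (X t)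

/-- `P f (x) = ∫ f(y) P(x, dy)`. -/
def act {N : ℕ} (κ : Kernel (Simplex N) (Simplex N)) (f : Simplex N → ℝ) (x : Simplex N) : ℝ :=
  ∫ y, f y ∂(κ x)

/-- Convergence in `L²` of the Dirichlet distribution, for functions on `Δ^(N)`. -/
def TendstoL2 {N : ℕ} {ι : Type} (α : Fin (N + 1) → ℝ) (f : ι → Simplex N → ℝ) (l : Filter ι)
    (u : Simplex N → ℝ) : Prop :=
  Tendsto (fun k => eLpNorm (fun x => f k x - u x) 2 (dirichletMeasure α)) l (𝓝 0)

/-- `u` lies in the domain of the `L²`-generator of `(P_t)` and is mapped to `v`: in `L²`,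
`(P_t u - u) / t → v` as `t ↓ 0`. -/
def IsGeneratorValue {N : ℕ} (α : Fin (N + 1) → ℝ) (κ : ℝ≥0 → Kernel (Simplex N) (Simplex N))
    (u v : Simplex N → ℝ) : Prop :=
  TendstoL2 α (fun (t : ℝ≥0) x => (act (κ t) u x - u x) / t) (𝓝[>] 0) v

/-- `(u, v)` lies in the `L²`-closure of the graph of `L` on `C²`. -/
def IsClosureValue {N : ℕ} (α : Fin (N + 1) → ℝ) (u v : Simplex N → ℝ) : Prop :=
  ∃ f : ℕ → (Fin N → ℝ) → ℝ, (∀ k, ContDiff ℝ 2 (f k)) ∧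
    TendstoL2 α (fun k x => f k x) atTop u ∧
    TendstoL2 α (fun k x => diffOp α (f k) x) atTop v

/-- The bilinear form `E(f,g) = ∫ (1 - |x|₁) ∑ n, x_n (∂_n f)(∂_n g) dμ` on `C²`. -/
def preForm {N : ℕ} (α : Fin (N + 1) → ℝ) (f g : (Fin N → ℝ) → ℝ) : ℝ :=
  ∫ x : Simplex N, rest x.1 * ∑ n, x.1 n * (pderiv n f x * pderiv n g x) ∂(dirichletMeasure α)

/-- A sequence of `C²` functions that converges to `u` in `L²` and is Cauchy for the form. -/
structure IsFormApprox {N : ℕ} (α : Fin (N + 1) → ℝ) (f : ℕ → (Fin N → ℝ) → ℝ)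
    (u : Simplex N → ℝ) : Prop where
  contDiff : ∀ k, ContDiff ℝ 2 (f k)
  tendsto : TendstoL2 α (fun k x => f k x) atTop u
  cauchy : Tendsto (fun p : ℕ × ℕ => preForm α (f p.1 - f p.2) (f p.1 - f p.2)) atTop (𝓝 0)

/-- The form on `C²` is closable in `L²`: a sequence that tends to zero in `L²` and is Cauchy for
the form has energies tending to zero. -/
def FormClosable {N : ℕ} (α : Fin (N + 1) → ℝ) : Prop :=
  ∀ f : ℕ → (Fin N → ℝ) → ℝ, IsFormApprox α f (fun _ => 0) →
    Tendsto (fun k => preForm α (f k) (f k)) atTop (𝓝 0)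

/-- `u ∈ L²` lies in the domain of the closure of the form, and the closure has the value
`E(u,u) = e`. When the form is closable, `e` is determined by `u`. -/
def IsFormValue {N : ℕ} (α : Fin (N + 1) → ℝ) (u : Simplex N → ℝ) (e : ℝ) : Prop :=
  MemLp u 2 (dirichletMeasure α) ∧ ∃ f : ℕ → (Fin N → ℝ) → ℝ, IsFormApprox α f u ∧
    Tendsto (fun k => preForm α (f k) (f k)) atTop (𝓝 e)

/-- The spectral gap
`inf {E(u,u) : u ∈ D(E), μ(u) = 0, μ(u²) = 1}`. -/
def spectralGap {N : ℕ} (α : Fin (N + 1) → ℝ) : ℝ :=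
  sInf {e | ∃ u : Simplex N → ℝ, IsFormValue α u e ∧
    ∫ x, u x ∂(dirichletMeasure α) = 0 ∧ ∫ x, u x ^ 2 ∂(dirichletMeasure α) = 1}

end DirichletDiffusion

end

open DirichletDiffusion

/-!
The proof rests on the fact that `L` maps polynomials to polynomials without raising the degree, so
that the martingale problem can be solved explicitly on them.

Write `s = ∑ n, x_n` and `A = ∑ n, (x_n ∂_n² + α_n ∂_n)`. On the simplex,
`L = (1 - s) A - α_{N+1} ∑ n, x_n ∂_n`, and `A` lowers the degree by one. On the leading homogeneous
part, of degree `d`, of a polynomial, `-L` therefore acts as `s A + α_{N+1} d`. Since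
`A s - s A` is a positive scalar in each degree, `s A` has only nonnegative eigenvalues
(`eigenvalue_nonneg_of_isHomogeneous`), and every nonconstant polynomial eigenvector of `-L` has an
eigenvalue at least `α_{N+1}` (`le_eigenvalue_of_totalDegree_pos`). The eigenvalue `α_{N+1}` is
attained by a linear function when `N ≥ 2` (`exists_eigenvector_last`).

Integration by parts in each coordinate, where the weight `x_n^{α_n} (1 - s)^{α_{N+1}}` vanishes at
both endpoints, shows that `L` is symmetric in `L²(μ)` with the form `E`
(`neg_integral_mul_diffOp`). So each polynomial is a finite sum of orthogonal polynomial
eigenvectors (`exists_eigenvector_decomposition`), and polynomials are dense in `L²(μ)`. This gives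
the Poincaré inequality, first for polynomials and then for `C²` functions, whose energy dominates
that of their projections to the polynomials of bounded degree (`poincare_contDiff`).

For a polynomial eigenvector `φ` of `-L` with eigenvalue `c`, the martingale problem says that
`P_t φ` solves `m' = -c m`, so `P_t φ = exp(-c t) φ` (`act_eigenvector`). Hence `μ` is invariant,
`P_t` is a symmetric contraction of `L²(μ)`, and the exponential decay follows from the lower bound
on the eigenvalues. Finally, the generator and the closure of `L` on `C²` are both characterized by
`⟨v, q⟩ = ⟨u, L q⟩` for all polynomials `q` (`isGeneratorValue_iff_isClosureValue`).
-/

noncomputable section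

namespace DirichletDiffusion

/-! ### The operator on polynomials and its eigenvalues -/

section Algebra

open MvPolynomial

variable {N : ℕ} (α : Fin (N + 1) → ℝ)

/-- The degree-lowering operator `A = ∑ n, (x_n ∂_n² + α_n ∂_n)` on polynomials. -/
def lowerOp : MvPolynomial (Fin N) ℝ →ₗ[ℝ] MvPolynomial (Fin N) ℝ :=
  ∑ n : Fin N, (LinearMap.mulLeft ℝ (X n) ∘ₗ
      (MvPolynomial.pderiv n).toLinearMap ∘ₗ (MvPolynomial.pderiv n).toLinearMap +
    α n.castSucc • (MvPolynomial.pderiv n).toLinearMap)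

/-- The Euler operator `∑ n, x_n ∂_n`. -/
def eulerOp : MvPolynomial (Fin N) ℝ →ₗ[ℝ] MvPolynomial (Fin N) ℝ :=
  ∑ n : Fin N, LinearMap.mulLeft ℝ (X n) ∘ₗ (MvPolynomial.pderiv n).toLinearMap

/-- The operator `L` on polynomials, written as `(1 - s) A - α_{N+1} ∑ n, x_n ∂_n` where
`s = ∑ n, x_n`. -/
def polyOp : MvPolynomial (Fin N) ℝ →ₗ[ℝ] MvPolynomial (Fin N) ℝ :=
  lowerOp α - LinearMap.mulLeft ℝ (∑ i, X i) ∘ₗ lowerOp α - α (Fin.last N) • eulerOp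

theorem lowerOp_apply (p : MvPolynomial (Fin N) ℝ) :
    lowerOp α p = ∑ n, (X n * MvPolynomial.pderiv n (MvPolynomial.pderiv n p) +
      α n.castSucc • MvPolynomial.pderiv n p) := by
  simp [lowerOp]

theorem eulerOp_apply (p : MvPolynomial (Fin N) ℝ) :
    eulerOp p = ∑ n, X n * MvPolynomial.pderiv n p := by
  simp [eulerOp]

theorem polyOp_apply (p : MvPolynomial (Fin N) ℝ) :
    polyOp α p = lowerOp α p - (∑ i, X i) * lowerOp α p - α (Fin.last N) • eulerOp p := by
  simp [polyOp]

theorem isHomogeneous_X_mul_pderiv {q : MvPolynomial (Fin N) ℝ} {d : ℕ} (hq : q.IsHomogeneous d)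
    (n : Fin N) : (X n * MvPolynomial.pderiv n q).IsHomogeneous d := by
  obtain _ | d := d
  · have h : q = C (coeff 0 q) := totalDegree_eq_zero_iff_eq_C.1
      ((totalDegree_zero_iff_isHomogeneous _).2 hq)
    rw [h, pderiv_C, mul_zero]
    exact isHomogeneous_zero _ _ _
  · rw [add_comm]
    exact (isHomogeneous_X ℝ n).mul hq.pderiv

theorem lowerOp_isHomogeneous {p : MvPolynomial (Fin N) ℝ} {d : ℕ} (hp : p.IsHomogeneous (d + 1)) :
    (lowerOp α p).IsHomogeneous d := by
  rw [lowerOp_apply]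
  refine IsHomogeneous.sum _ _ _ fun n _ => ?_
  have h : (MvPolynomial.pderiv n p).IsHomogeneous d := hp.pderiv
  refine (isHomogeneous_X_mul_pderiv h n).add ?_
  rw [smul_eq_C_mul]
  exact h.C_mul _

theorem lowerOp_of_isHomogeneous_zero {p : MvPolynomial (Fin N) ℝ} (hp : p.IsHomogeneous 0) :
    lowerOp α p = 0 := by
  have h : p = C (coeff 0 p) := totalDegree_eq_zero_iff_eq_C.1
    ((totalDegree_zero_iff_isHomogeneous _).2 hp)
  rw [lowerOp_apply, h]
  simp

theorem eulerOp_of_isHomogeneous {p : MvPolynomial (Fin N) ℝ} {d : ℕ} (hp : p.IsHomogeneous d) :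
    eulerOp p = (d : ℝ) • p := by
  rw [eulerOp_apply, hp.sum_X_mul_pderiv, Nat.cast_smul_eq_nsmul]

/-- The commutation relation of `A` with multiplication by `s = ∑ n, x_n` on homogeneous
polynomials. -/
theorem lowerOp_sum_X_mul {p : MvPolynomial (Fin N) ℝ} {d : ℕ} (hp : p.IsHomogeneous d) :
    lowerOp α ((∑ i, X i) * p) = (∑ i, X i) * lowerOp α p
      + (2 * d + ∑ n : Fin N, α n.castSucc) • p := by
  have h1 (n : Fin N) (q : MvPolynomial (Fin N) ℝ) :
      MvPolynomial.pderiv n ((∑ i, X i) * q) = q + (∑ i, X i) * MvPolynomial.pderiv n q := by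
    have h2 : MvPolynomial.pderiv n (∑ i, X i : MvPolynomial (Fin N) ℝ) = 1 := by
      rw [map_sum]
      simp [pderiv_X, Pi.single_apply]
    rw [pderiv_mul, h2, one_mul]
  have hE := eulerOp_of_isHomogeneous hp
  rw [eulerOp_apply] at hE
  rw [add_smul, mul_smul, ← hE, lowerOp_apply, lowerOp_apply, Finset.mul_sum, Finset.sum_smul,
    Finset.smul_sum, ← Finset.sum_add_distrib, ← Finset.sum_add_distrib]
  refine Finset.sum_congr rfl fun n _ => ?_
  rw [h1, map_add, h1]
  simp only [smul_eq_C_mul, map_ofNat]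
  ring

/-- `s A` has only nonnegative eigenvalues on homogeneous polynomials: by the commutation relation,
`A` carries an eigenvector of degree `d + 1` with eigenvalue `c ≠ 0` to one of degree `d` with
eigenvalue `c - (2 d + ∑ n, α_n)`. -/
theorem eigenvalue_nonneg_of_isHomogeneous (hα : ∀ i, 0 < α i) {d : ℕ}
    {p : MvPolynomial (Fin N) ℝ} (hp : p.IsHomogeneous d) (hp0 : p ≠ 0) {c : ℝ}
    (hc : (∑ i, X i) * lowerOp α p = c • p) : 0 ≤ c := by
  induction d generalizing p c with
  | zero =>
    rw [lowerOp_of_isHomogeneous_zero α hp, mul_zero] at hc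
    rcases smul_eq_zero.1 hc.symm with h | h
    · exact h.ge
    · exact absurd h hp0
  | succ d ih =>
    by_cases hc0 : c = 0
    · exact hc0.ge
    have hA : (lowerOp α p).IsHomogeneous d := lowerOp_isHomogeneous α hp
    have hA0 : lowerOp α p ≠ 0 := fun h => by
      rw [h, mul_zero] at hc
      exact (smul_ne_zero hc0 hp0) hc.symm
    have key := lowerOp_sum_X_mul α hA
    rw [hc, map_smul] at key
    have h := ih hA hA0 (c := c - (2 * d + ∑ n : Fin N, α n.castSucc)) (by
      rw [sub_smul, key]; abel)
    have : 0 ≤ ∑ n : Fin N, α n.castSucc := Finset.sum_nonneg fun i _ => (hα _).le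
    have : (0 : ℝ) ≤ d := d.cast_nonneg
    linarith

/-- The homogeneous components of `L p`. -/
theorem homogeneousComponent_polyOp (d : ℕ) (p : MvPolynomial (Fin N) ℝ) :
    homogeneousComponent d (polyOp α p) = lowerOp α (homogeneousComponent (d + 1) p)
      - (∑ i, X i) * lowerOp α (homogeneousComponent d p)
      - (α (Fin.last N) * d) • homogeneousComponent d p := by
  induction p using MvPolynomial.induction_on' with
  | add p q hp hq =>
    simp only [map_add, hp, hq, mul_add, smul_add]
    abel
  | monomial m r =>
    have h : (monomial m r : MvPolynomial (Fin N) ℝ).IsHomogeneous m.degree :=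
      isHomogeneous_monomial r rfl
    generalize monomial m r = p at h
    generalize m.degree = e at h
    rw [polyOp_apply, eulerOp_of_isHomogeneous h]
    obtain _ | e := e
    · rw [lowerOp_of_isHomogeneous_zero α h]
      simp only [map_sub, map_smul, homogeneousComponent_of_mem h]
      by_cases hd : d = 0 <;> simp [hd, lowerOp_of_isHomogeneous_zero α h]
    · have h1 := lowerOp_isHomogeneous α h
      have h2 : ((∑ i, X i) * lowerOp α p).IsHomogeneous (e + 1) := by
        rw [add_comm]
        exact (IsHomogeneous.sum _ _ _ fun n _ => isHomogeneous_X ℝ n).mul h1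
      simp only [map_sub, map_smul, homogeneousComponent_of_mem h, homogeneousComponent_of_mem h1,
        homogeneousComponent_of_mem h2]
      by_cases hd : d = e
      · simp [hd]
      · by_cases hd' : d = e + 1
        · simp [hd', mul_smul]
        · simp [hd, hd']

theorem totalDegree_polyOp_le {p : MvPolynomial (Fin N) ℝ} {d : ℕ} (hp : p.totalDegree ≤ d) :
    (polyOp α p).totalDegree ≤ d := by
  refine Finset.sup_le fun m hm => ?_
  by_contra! h
  have h' : d < m.degree := h
  have h0 : coeff m (homogeneousComponent m.degree (polyOp α p)) = coeff m (polyOp α p) := by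
    rw [coeff_homogeneousComponent, if_pos rfl]
  rw [homogeneousComponent_polyOp, homogeneousComponent_eq_zero _ _ (hp.trans_lt h'),
    homogeneousComponent_eq_zero _ _ (hp.trans_lt (h'.trans (Nat.lt_succ_self _)))] at h0
  simp only [map_zero, mul_zero, smul_zero, sub_zero, coeff_zero] at h0
  exact mem_support_iff.1 hm h0.symm

/-- An eigenvalue of `-L` on polynomials that belongs to a nonconstant eigenvector is at least
`α_{N+1}`: on the leading homogeneous component, of degree `d`, the operator `-L` acts as
`s A + α_{N+1} d`. -/
theorem le_eigenvalue_of_totalDegree_pos (hα : ∀ i, 0 < α i) {p : MvPolynomial (Fin N) ℝ}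
    (hp : p.totalDegree ≠ 0) {c : ℝ} (hc : polyOp α p = -c • p) : α (Fin.last N) ≤ c := by
  set d := p.totalDegree with hd
  have h0 : homogeneousComponent (d + 1) p = 0 :=
    homogeneousComponent_eq_zero _ _ (Nat.lt_succ_self _)
  have hne : homogeneousComponent d p ≠ 0 := by
    have hne0 : p.support.Nonempty := by
      rw [Finset.nonempty_iff_ne_empty]
      exact fun h => hp (by simp [hd, totalDegree, h])
    obtain ⟨m, hm, hmd⟩ := Finset.exists_mem_eq_sup p.support hne0
      (fun s : Fin N →₀ ℕ => s.sum fun _ e => e)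
    have hmd' : m.degree = d := hmd.symm
    intro h
    have h1 := congrArg (coeff m) h
    rw [coeff_homogeneousComponent, if_pos hmd', coeff_zero] at h1
    exact mem_support_iff.1 hm h1
  have h := homogeneousComponent_polyOp α d p
  rw [h0, map_zero, zero_sub, hc, map_smul, neg_smul] at h
  have h' : (∑ i, X i) * lowerOp α (homogeneousComponent d p) =
      (c - α (Fin.last N) * d) • homogeneousComponent d p := by
    rw [sub_smul]
    rw [← sub_eq_zero]
    rw [← sub_eq_zero] at h
    rw [← h]
    abel
  have := eigenvalue_nonneg_of_isHomogeneous α hα (homogeneousComponent_isHomogeneous d p) hne h'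
  have hd1 : (1 : ℝ) ≤ d := by exact_mod_cast Nat.one_le_iff_ne_zero.2 hp
  nlinarith [hα (Fin.last N)]

end Algebra

/-! ### The Dirichlet integral -/

/-- The beta integral over `(0, r)`. -/
theorem setLIntegral_rpow_mul_sub_rpow {u v r : ℝ} (hu : 0 < u) (hv : 0 < v) (hr : 0 < r) :
    ∫⁻ x in Set.Ioo 0 r, ENNReal.ofReal (x ^ (u - 1) * (r - x) ^ (v - 1)) =
      ENNReal.ofReal (r ^ (u + v - 1) * beta u v) := by
  have himg : Set.Ioo 0 r = (fun x => r * x) '' Set.Ioo 0 1 := by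
    rw [Set.image_mul_left_Ioo hr, mul_zero, mul_one]
  rw [himg, lintegral_image_eq_lintegral_abs_deriv_mul (f' := fun _ => r) measurableSet_Ioo
    (fun x _ => by simpa using (hasDerivAt_id x).const_mul r |>.hasDerivWithinAt)
    (mul_right_injective₀ hr.ne').injOn]
  have hb := beta_pos hu hv
  have h1 := lintegral_betaPDF_eq_one hu hv
  rw [lintegral_betaPDF] at h1
  calc _ = ∫⁻ x in Set.Ioo (0 : ℝ) 1, ENNReal.ofReal (r ^ (u + v - 1) * beta u v) *
        ENNReal.ofReal (1 / beta u v * x ^ (u - 1) * (1 - x) ^ (v - 1)) := by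
        refine setLIntegral_congr_fun measurableSet_Ioo fun x hx => ?_
        have hx1 : 0 < 1 - x := by linarith [hx.2]
        rw [← ENNReal.ofReal_mul (abs_nonneg _), ← ENNReal.ofReal_mul (by positivity)]
        congr 1
        have e1 : r - r * x = r * (1 - x) := by ring
        have e2 : r ^ (u + v - 1) = r * (r ^ (u - 1) * r ^ (v - 1)) := by
          rw [← Real.rpow_add hr]
          nth_rewrite 2 [← Real.rpow_one r]
          rw [← Real.rpow_add hr]
          congr 1; ring
        rw [e1, Real.mul_rpow hr.le hx.1.le, Real.mul_rpow hr.le hx1.le, e2, abs_of_pos hr]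
        field_simp
    _ = _ := by rw [lintegral_const_mul' _ _ ENNReal.ofReal_ne_top, h1, mul_one]

/-- The open simplex `{x | 0 < x_i, ∑ x_i < r}`; it is empty when `r ≤ 0`. -/
def openSimplex (N : ℕ) (r : ℝ) : Set (Fin N → ℝ) :=
  {x | (∀ i, 0 < x i) ∧ ∑ i, x i < r}

theorem isOpen_openSimplex (N : ℕ) (r : ℝ) : IsOpen (openSimplex N r) := by
  have h : openSimplex N r = (⋂ i, {x | 0 < x i}) ∩ {x | ∑ i, x i < r} := by
    ext x; simp [openSimplex]
  rw [h]
  exact (isOpen_iInter_of_finite fun i => isOpen_lt continuous_const (continuous_apply i)).inter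
    (isOpen_lt (by fun_prop) continuous_const)

theorem measurableSet_openSimplex (N : ℕ) (r : ℝ) : MeasurableSet (openSimplex N r) :=
  (isOpen_openSimplex N r).measurableSet

theorem insertNth_mem_openSimplex {N : ℕ} {r t : ℝ} {i : Fin (N + 1)} {y : Fin N → ℝ} :
    i.insertNth t y ∈ openSimplex (N + 1) r ↔ 0 < t ∧ y ∈ openSimplex N (r - t) := by
  simp only [openSimplex, Set.mem_ofPred_eq, Fin.forall_iff_succAbove i, Fin.insertNth_apply_same,
    Fin.insertNth_apply_succAbove, Fin.sum_univ_succAbove _ i, and_assoc]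
  refine and_congr_right fun _ => and_congr_right fun _ => ?_
  rw [lt_sub_iff_add_lt']

/-- The Dirichlet integral over the simplex of size `r`, by induction on the dimension: the first
coordinate `t` leaves a simplex of size `r - t`, and the remaining integral over `t` is a beta
integral. -/
theorem lintegral_openSimplex_weight {N : ℕ} (β : Fin N → ℝ) (hβ : ∀ i, 0 < β i) {a : ℝ}
    (ha : 0 < a) {r : ℝ} (hr : 0 < r) :
    ∫⁻ x, (openSimplex N r).indicator
        (fun x => ENNReal.ofReal ((r - ∑ i, x i) ^ (a - 1) * ∏ i, x i ^ (β i - 1))) x =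
      ENNReal.ofReal (Real.Gamma a * (∏ i, Real.Gamma (β i)) / Real.Gamma (a + ∑ i, β i) *
        r ^ (a + ∑ i, β i - 1)) := by
  induction N generalizing r with
  | zero =>
    have h0 (x : Fin 0 → ℝ) : x ∈ openSimplex 0 r := by simp [openSimplex, hr]
    rw [lintegral_unique, Set.indicator_of_mem (h0 _)]
    simp [volume_pi, (Real.Gamma_pos_of_pos ha).ne']
  | succ N ih =>
    set b := ∑ i : Fin N, β i.succ with hb
    set G := Real.Gamma a * (∏ i : Fin N, Real.Gamma (β i.succ)) / Real.Gamma (a + b) with hG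
    have hb0 : 0 ≤ b := Finset.sum_nonneg fun i _ => (hβ _).le
    have hG0 : 0 < G := div_pos (mul_pos (Real.Gamma_pos_of_pos ha)
      (Finset.prod_pos fun i _ => Real.Gamma_pos_of_pos (hβ _)))
      (Real.Gamma_pos_of_pos (by linarith))
    have hmp := (volume_preserving_piFinSuccAbove (fun _ : Fin (N + 1) => ℝ) 0).symm
    have hmeas : Measurable ((openSimplex (N + 1) r).indicator
        (fun x => ENNReal.ofReal ((r - ∑ i, x i) ^ (a - 1) * ∏ i, x i ^ (β i - 1)))) :=
      Measurable.indicator (by fun_prop) (measurableSet_openSimplex _ _)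
    rw [hmp.lintegral_map_equiv, Measure.volume_eq_prod,
      lintegral_prod _ (by exact (hmeas.comp (MeasurableEquiv.measurable _)).aemeasurable)]
    have hinner (t : ℝ) : ∫⁻ y : Fin N → ℝ, (openSimplex (N + 1) r).indicator
        (fun x => ENNReal.ofReal ((r - ∑ i, x i) ^ (a - 1) * ∏ i, x i ^ (β i - 1)))
          ((MeasurableEquiv.piFinSuccAbove (fun _ : Fin (N + 1) => ℝ) 0).symm (t, y)) =
        (Set.Ioo 0 r).indicator (fun t => ENNReal.ofReal G *
          ENNReal.ofReal (t ^ (β 0 - 1) * (r - t) ^ (a + b - 1))) t := by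
      have hins (y : Fin N → ℝ) : (MeasurableEquiv.piFinSuccAbove (fun _ : Fin (N + 1) => ℝ) 0).symm
          (t, y) = Fin.insertNth 0 t y := rfl
      simp only [hins]
      by_cases ht : t ∈ Set.Ioo 0 r
      · have hrt : 0 < r - t := by linarith [ht.2]
        rw [Set.indicator_of_mem ht, ← ENNReal.ofReal_mul hG0.le]
        have := ih (fun i => β i.succ) (fun i => hβ _) hrt
        rw [← hb, ← hG] at this
        have e : G * (t ^ (β 0 - 1) * (r - t) ^ (a + b - 1)) =
          t ^ (β 0 - 1) * (G * (r - t) ^ (a + b - 1)) := by ring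
        rw [e, ENNReal.ofReal_mul (Real.rpow_nonneg ht.1.le _), ← this,
          ← lintegral_const_mul' _ _ ENNReal.ofReal_ne_top]
        refine lintegral_congr fun y => ?_
        by_cases hy : y ∈ openSimplex N (r - t)
        · rw [Set.indicator_of_mem (insertNth_mem_openSimplex.2 ⟨ht.1, hy⟩),
            Set.indicator_of_mem hy, ← ENNReal.ofReal_mul (Real.rpow_nonneg ht.1.le _)]
          congr 1
          simp only [Fin.sum_univ_succ, Fin.prod_univ_succ, Fin.insertNth_zero', Fin.cons_zero,
            Fin.cons_succ, sub_sub]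
          ring
        · rw [Set.indicator_of_notMem (fun h => hy (insertNth_mem_openSimplex.1 h).2),
            Set.indicator_of_notMem hy, mul_zero]
      · rw [Set.indicator_of_notMem ht, lintegral_eq_zero_of_ae_eq_zero]
        refine Eventually.of_forall fun y => Set.indicator_of_notMem (fun h => ht ?_) _
        obtain ⟨h1, h2, h3⟩ := insertNth_mem_openSimplex.1 h
        exact ⟨h1, by linarith [Finset.sum_nonneg fun i (_ : i ∈ Finset.univ) => (h2 i).le]⟩
    rw [lintegral_congr hinner, lintegral_indicator measurableSet_Ioo,
      lintegral_const_mul' _ _ ENNReal.ofReal_ne_top,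
      setLIntegral_rpow_mul_sub_rpow (hβ 0) (by linarith) hr, ← ENNReal.ofReal_mul hG0.le]
    congr 1
    have h1 := (Real.Gamma_pos_of_pos (show 0 < a + b by linarith)).ne'
    rw [Fin.sum_univ_succ, Fin.prod_univ_succ, ← hb, hG, beta,
      show β 0 + (a + b) = a + (β 0 + b) by ring]
    field_simp

/-- The simplex and its interior differ by a Lebesgue null set. -/
theorem simplexSet_ae_eq (N : ℕ) :
    (simplexSet N : Set (Fin N → ℝ)) =ᵐ[volume] openSimplex N 1 := by
  have hsub : openSimplex N 1 ⊆ simplexSet N := fun x hx => by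
    refine ⟨fun i => ⟨(hx.1 i).le, ?_⟩, hx.2.le⟩
    exact (Finset.single_le_sum (fun j _ => (hx.1 j).le) (Finset.mem_univ i)).trans hx.2.le
  have h1 : ∀ i : Fin N, volume {x : Fin N → ℝ | x i = 0} = 0 := fun i => by
    rw [volume_pi]; exact Measure.pi_hyperplane _ i 0
  have h2 : volume {x : Fin N → ℝ | ∑ i, x i = 1} = 0 := by
    let s : AffineSubspace ℝ (Fin N → ℝ) :=
      { carrier := {x | ∑ i, x i = 1}
        smul_vsub_vadd_mem' := fun c p q r hp hq hr => by
          simp only [Set.mem_ofPred_eq] at hp hq hr ⊢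
          simp [Finset.sum_add_distrib, ← Finset.mul_sum, hp, hq, hr] }
    refine Measure.addHaar_affineSubspace volume s fun h => ?_
    have : (0 : Fin N → ℝ) ∈ s := h ▸ AffineSubspace.mem_top ℝ _ _
    have h0 : ∑ i : Fin N, (0 : Fin N → ℝ) i = 1 := this
    simp at h0
  refine ae_eq_set.2 ⟨?_, by rw [Set.sdiff_eq_empty.2 hsub, measure_empty]⟩
  refine measure_mono_null (t := (⋃ i, {x : Fin N → ℝ | x i = 0}) ∪ {x | ∑ i, x i = 1}) ?_
    (measure_union_null (measure_iUnion_null h1) h2)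
  rintro x ⟨hx, hx'⟩
  by_contra! h
  simp only [Set.mem_union, Set.mem_iUnion, Set.mem_ofPred_eq, not_or, not_exists] at h
  exact hx' ⟨fun i => lt_of_le_of_ne (hx.1 i).1 (Ne.symm (h.1 i)), lt_of_le_of_ne hx.2 h.2⟩


theorem isCompact_simplexSet (N : ℕ) : IsCompact (simplexSet N) := by
  have h : simplexSet N = Set.univ.pi (fun _ => Set.Icc (0 : ℝ) 1) ∩ {x | ∑ i, x i ≤ 1} := by
    ext x; simp only [simplexSet, Set.mem_inter_iff, Set.mem_univ_pi, Set.mem_ofPred_eq]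
  rw [h]
  exact (isCompact_univ_pi fun _ => isCompact_Icc).inter_right
    (isClosed_le (by fun_prop) continuous_const)

theorem measurableSet_simplexSet (N : ℕ) : MeasurableSet (simplexSet N) :=
  (isCompact_simplexSet N).measurableSet

instance compactSpace_simplex (N : ℕ) : CompactSpace (Simplex N) :=
  isCompact_iff_compactSpace.1 (isCompact_simplexSet N)

theorem continuous_rest {N : ℕ} : Continuous (rest : (Fin N → ℝ) → ℝ) := by
  unfold rest; fun_prop

theorem rest_eq {N : ℕ} {x : Fin N → ℝ} (hx : ∀ i, 0 ≤ x i) : rest x = 1 - ∑ i, x i := by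
  unfold rest
  rw [Finset.sum_congr rfl fun i _ => abs_of_nonneg (hx i)]

section Measure

variable {N : ℕ} {α : Fin (N + 1) → ℝ}

theorem measurable_dirichletDensity : Measurable (dirichletDensity α) := by
  have := (continuous_rest (N := N)).measurable
  unfold dirichletDensity; fun_prop

/-- The normalizing constant of the Dirichlet density. -/
def dirichletConst (α : Fin (N + 1) → ℝ) : ℝ := Real.Gamma (∑ i, α i) / ∏ i, Real.Gamma (α i)

theorem dirichletConst_pos (hα : ∀ i, 0 < α i) : 0 < dirichletConst α :=
  div_pos (Real.Gamma_pos_of_pos (Finset.sum_pos (fun i _ => hα i) Finset.univ_nonempty))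
    (Finset.prod_pos fun i _ => Real.Gamma_pos_of_pos (hα i))

theorem dirichletDensity_of_mem {x : Fin N → ℝ} (hx : x ∈ openSimplex N 1) :
    dirichletDensity α x = dirichletConst α *
      ((1 - ∑ i, x i) ^ (α (Fin.last N) - 1) * ∏ i, x i ^ (α i.castSucc - 1)) := by
  rw [dirichletDensity, rest_eq fun i => (hx.1 i).le, dirichletConst, mul_assoc]

theorem dirichletDensity_pos (hα : ∀ i, 0 < α i) {x : Fin N → ℝ} (hx : x ∈ openSimplex N 1) :
    0 < dirichletDensity α x := by
  rw [dirichletDensity_of_mem hx]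
  have := dirichletConst_pos hα
  have h1 : 0 < 1 - ∑ i, x i := by linarith [hx.2]
  have h2 : 0 < ∏ i, x i ^ (α i.castSucc - 1) :=
    Finset.prod_pos fun i _ => Real.rpow_pos_of_pos (hx.1 i) _
  positivity

theorem setLIntegral_dirichletDensity (hα : ∀ i, 0 < α i) :
    ∫⁻ x in openSimplex N 1, ENNReal.ofReal (dirichletDensity α x) = 1 := by
  have h0 := dirichletConst_pos hα
  have h := lintegral_openSimplex_weight (fun i : Fin N => α i.castSucc) (fun i => hα _)
    (hα (Fin.last N)) one_pos
  rw [lintegral_indicator (measurableSet_openSimplex N 1)] at h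
  rw [setLIntegral_congr_fun (measurableSet_openSimplex N 1) (fun x hx => by
    rw [dirichletDensity_of_mem hx, ENNReal.ofReal_mul h0.le]),
    lintegral_const_mul' _ _ ENNReal.ofReal_ne_top, h, ← ENNReal.ofReal_mul h0.le, Real.one_rpow,
    dirichletConst, Fin.sum_univ_castSucc, Fin.prod_univ_castSucc, add_comm (α (Fin.last N)),
    mul_comm (Real.Gamma (α (Fin.last N))), mul_one, div_mul_div_cancel₀, div_self,
    ENNReal.ofReal_one]
  · exact (Real.Gamma_pos_of_pos (add_pos_of_nonneg_of_pos
      (Finset.sum_nonneg fun i _ => (hα _).le) (hα _))).ne'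
  · exact (mul_pos (Finset.prod_pos fun i _ => Real.Gamma_pos_of_pos (hα _))
      (Real.Gamma_pos_of_pos (hα _))).ne'

theorem isProbabilityMeasure_dirichletMeasure (hα : ∀ i, 0 < α i) :
    IsProbabilityMeasure (dirichletMeasure α) := by
  refine ⟨?_⟩
  rw [dirichletMeasure, withDensity_apply _ MeasurableSet.univ, Measure.restrict_univ,
    lintegral_subtype_comap (measurableSet_simplexSet N)
      (fun x => ENNReal.ofReal (dirichletDensity α x)),
    setLIntegral_congr (simplexSet_ae_eq N), setLIntegral_dirichletDensity hα]

theorem integral_dirichletMeasure (hα : ∀ i, 0 < α i) (g : (Fin N → ℝ) → ℝ) :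
    ∫ x : Simplex N, g x ∂(dirichletMeasure α) =
      ∫ x in openSimplex N 1, dirichletDensity α x * g x := by
  rw [dirichletMeasure, integral_withDensity_eq_integral_toReal_smul
    (by exact (measurable_dirichletDensity.comp measurable_subtype_coe).ennreal_ofReal)
    (Eventually.of_forall fun _ => ENNReal.ofReal_lt_top),
    integral_subtype_comap (measurableSet_simplexSet N)
      (fun x => (ENNReal.ofReal (dirichletDensity α x)).toReal • g x),
    setIntegral_congr_set (simplexSet_ae_eq N)]
  refine setIntegral_congr_fun (measurableSet_openSimplex N 1) fun x hx => ?_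
  simp only [smul_eq_mul]
  rw [ENNReal.toReal_ofReal (dirichletDensity_pos hα hx).le]

theorem integrableOn_dirichletDensity (hα : ∀ i, 0 < α i) :
    IntegrableOn (dirichletDensity α) (openSimplex N 1) := by
  refine ⟨measurable_dirichletDensity.aestronglyMeasurable, ?_⟩
  rw [hasFiniteIntegral_iff_ofReal, setLIntegral_dirichletDensity hα]
  · exact ENNReal.one_lt_top
  · exact ae_restrict_of_forall_mem (measurableSet_openSimplex N 1)
      fun x hx => (dirichletDensity_pos hα hx).le

theorem integrableOn_dirichletDensity_mul (hα : ∀ i, 0 < α i) {g : (Fin N → ℝ) → ℝ}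
    (hg : Continuous g) :
    IntegrableOn (fun x => dirichletDensity α x * g x) (openSimplex N 1) :=
  (((integrableOn_dirichletDensity hα).congr_set_ae (simplexSet_ae_eq N)).mul_continuousOn
    hg.continuousOn (isCompact_simplexSet N)).congr_set_ae (simplexSet_ae_eq N).symm

/-- The Dirichlet distribution charges every nonempty open subset of the open simplex. -/
theorem eqOn_zero_of_ae_eq_zero (hα : ∀ i, 0 < α i) {g : (Fin N → ℝ) → ℝ} (hg : Continuous g)
    (h : ∀ᵐ x : Simplex N ∂(dirichletMeasure α), g x = 0) : Set.EqOn g 0 (openSimplex N 1) := by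
  have h1 : ∫ x : Simplex N, g x ^ 2 ∂(dirichletMeasure α) = 0 := by
    rw [integral_congr_ae (g := fun _ => 0) (h.mono fun x hx => by simp [hx]), integral_zero]
  rw [integral_dirichletMeasure hα (fun x => g x ^ 2), setIntegral_eq_zero_iff_of_nonneg_ae
    (ae_restrict_of_forall_mem (measurableSet_openSimplex N 1)
      fun x hx => mul_nonneg (dirichletDensity_pos hα hx).le (sq_nonneg _))
    (integrableOn_dirichletDensity_mul hα (hg.pow 2))] at h1
  refine Measure.eqOn_open_of_ae_eq (μ := volume) ?_ (isOpen_openSimplex N 1) hg.continuousOn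
    continuousOn_const
  filter_upwards [h1, ae_restrict_mem (measurableSet_openSimplex N 1)] with x hx hx'
  rcases mul_eq_zero.1 hx with h | h
  · exact absurd h (dirichletDensity_pos hα hx').ne'
  · simpa using h

/-- A polynomial that vanishes almost everywhere for the Dirichlet distribution is zero. -/
theorem polynomial_eq_zero_of_ae_eq_zero (hα : ∀ i, 0 < α i) {p : MvPolynomial (Fin N) ℝ}
    (h : ∀ᵐ x : Simplex N ∂(dirichletMeasure α), MvPolynomial.eval x.1 p = 0) : p = 0 := by
  have h1 := eqOn_zero_of_ae_eq_zero hα (MvPolynomial.continuous_eval p) h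
  have hN : (0 : ℝ) < 1 / (N + 1) := by positivity
  refine MvPolynomial.funext_set (fun _ => Set.Ioo (0 : ℝ) (1 / (N + 1)))
    (fun _ => Set.Ioo_infinite hN) fun x hx => ?_
  rw [map_zero]
  refine h1 ⟨fun i => (hx i (Set.mem_univ i)).1, ?_⟩
  calc ∑ i, x i ≤ ∑ _i : Fin N, 1 / ((N : ℝ) + 1) :=
        Finset.sum_le_sum fun i _ => (hx i (Set.mem_univ i)).2.le
    _ = N / (N + 1) := by simp [div_eq_mul_inv]
    _ < 1 := by rw [div_lt_one (by positivity)]; linarith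

end Measure

/-! ### Integration by parts -/

/-- One-dimensional integration by parts against the weight `t^(p-1) (r-t)^(q-1)`: the integrand is
the derivative of `t^p (r-t)^q v(t)`, which vanishes at both endpoints. -/
theorem setIntegral_weight_deriv_eq_zero {p q r : ℝ} (hp : 0 < p) (hq : 0 < q) (hr : 0 < r)
    {v v' : ℝ → ℝ} (hv : ∀ t, HasDerivAt v (v' t) t) (hv' : Continuous v') :
    ∫ t in Set.Ioo 0 r, t ^ (p - 1) * (r - t) ^ (q - 1) *
      (t * (r - t) * v' t + (p * (r - t) - q * t) * v t) = 0 := by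
  have hvc : Continuous v := continuous_iff_continuousAt.2 fun t => (hv t).continuousAt
  have hw : IntegrableOn (fun t : ℝ => t ^ (p - 1) * (r - t) ^ (q - 1)) (Set.Ioo 0 r) := by
    refine ⟨(by fun_prop : Measurable _).aestronglyMeasurable, ?_⟩
    rw [hasFiniteIntegral_iff_ofReal, setLIntegral_rpow_mul_sub_rpow hp hq hr]
    · exact ENNReal.ofReal_lt_top
    · exact ae_restrict_of_forall_mem measurableSet_Ioo fun t ht =>
        mul_nonneg (Real.rpow_nonneg ht.1.le _) (Real.rpow_nonneg (by linarith [ht.2]) _)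
  have hint : IntegrableOn (fun t : ℝ => t ^ (p - 1) * (r - t) ^ (q - 1) *
      (t * (r - t) * v' t + (p * (r - t) - q * t) * v t)) (Set.Icc 0 r) :=
    (hw.congr_set_ae Ioo_ae_eq_Icc.symm).mul_continuousOn (by fun_prop) isCompact_Icc
  have key := intervalIntegral.integral_eq_sub_of_hasDerivAt_of_le
    (f := fun t => t ^ p * (r - t) ^ q * v t) hr.le ?_ (fun t ht => ?_)
    ((intervalIntegrable_iff_integrableOn_Icc_of_le hr.le).2 hint)
  · rw [← integral_Ioc_eq_integral_Ioo, ← intervalIntegral.integral_of_le hr.le, key]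
    simp [Real.zero_rpow hp.ne', Real.zero_rpow hq.ne']
  · have h1 : Continuous fun t : ℝ => t ^ p := Real.continuous_rpow_const hp.le
    have h2 : Continuous fun t : ℝ => (r - t) ^ q :=
      (Real.continuous_rpow_const hq.le).comp (continuous_const.sub continuous_id)
    exact ((h1.mul h2).mul hvc).continuousOn
  · have ht' : 0 < r - t := by linarith [ht.2]
    have h1 : HasDerivAt (fun t : ℝ => t ^ p) (p * t ^ (p - 1)) t :=
      Real.hasDerivAt_rpow_const (Or.inl ht.1.ne')
    have h2 : HasDerivAt (fun t : ℝ => (r - t) ^ q) (-1 * q * (r - t) ^ (q - 1)) t :=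
      ((hasDerivAt_id t).const_sub r).rpow_const (Or.inl ht'.ne')
    refine ((h1.mul h2).mul (hv t)).congr_deriv ?_
    have e1 : t ^ p = t ^ (p - 1) * t := by
      rw [← Real.rpow_add_one ht.1.ne']; congr 1; ring
    have e2 : (r - t) ^ q = (r - t) ^ (q - 1) * (r - t) := by
      rw [← Real.rpow_add_one ht'.ne']; congr 1; ring
    simp only [Pi.mul_apply, e1, e2]
    ring

variable {N : ℕ} {α : Fin (N + 1) → ℝ}

theorem continuous_pderiv {f : (Fin N → ℝ) → ℝ} (hf : ContDiff ℝ 1 f) (n : Fin N) :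
    Continuous (pderiv n f) :=
  (hf.continuous_fderiv one_ne_zero).clm_apply continuous_const

theorem contDiff_pderiv {f : (Fin N → ℝ) → ℝ} (hf : ContDiff ℝ 2 f) (n : Fin N) :
    ContDiff ℝ 1 (pderiv n f) :=
  (hf.fderiv_right (m := 1) (by norm_num)).clm_apply contDiff_const

theorem hasDerivAt_insertNth {M : ℕ} {u : (Fin (M + 1) → ℝ) → ℝ} (hu : ContDiff ℝ 1 u)
    (n : Fin (M + 1)) (y : Fin M → ℝ) (t : ℝ) :
    HasDerivAt (fun s : ℝ => u (n.insertNth s y)) (pderiv n u (n.insertNth t y)) t := by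
  have h1 : HasDerivAt (fun s : ℝ => (n.insertNth s y : Fin (M + 1) → ℝ)) (Pi.single n 1) t := by
    have := hasDerivAt_update (𝕜 := ℝ) (n.insertNth 0 y : Fin (M + 1) → ℝ) n t
    refine this.congr_of_eventuallyEq (Eventually.of_forall fun s => ?_)
    rw [Fin.update_insertNth]
  exact ((hu.differentiable one_ne_zero) _).hasFDerivAt.comp_hasDerivAt t h1

theorem continuous_drift (n : Fin N) : Continuous (drift α n) := by
  have := continuous_rest (N := N)
  unfold drift; fun_prop

/-- Divergence theorem for the Dirichlet distribution, in the `n`-th coordinate direction: by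
Fubini's theorem it reduces to segments parallel to that direction. -/
theorem integral_divergence_eq_zero (hα : ∀ i, 0 < α i) {u : (Fin N → ℝ) → ℝ}
    (hu : ContDiff ℝ 1 u) (n : Fin N) :
    ∫ x : Simplex N, (x.1 n * rest x.1 * pderiv n u x + drift α n x * u x)
      ∂(dirichletMeasure α) = 0 := by
  have hpd := continuous_pderiv hu n
  have hr := continuous_rest (N := N)
  have hd := continuous_drift (α := α) n
  have hint := integrableOn_dirichletDensity_mul hα
    (g := fun x => x n * rest x * pderiv n u x + drift α n x * u x)
    (by have := hu.continuous; fun_prop)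
  rw [integral_dirichletMeasure hα (fun x => x n * rest x * pderiv n u x + drift α n x * u x),
    ← integral_indicator (measurableSet_openSimplex N 1)]
  rw [← integrable_indicator_iff (measurableSet_openSimplex N 1)] at hint
  obtain _ | M := N
  · exact n.elim0
  have hmp := (volume_preserving_piFinSuccAbove (fun _ : Fin (M + 1) => ℝ) n).symm
  rw [← hmp.integral_comp', Measure.volume_eq_prod, integral_prod_symm _
    (by exact (hmp.integrable_comp_emb (MeasurableEquiv.measurableEmbedding _)).2 hint)]
  refine integral_eq_zero_of_ae (Eventually.of_forall fun y => ?_)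
  have hins (t : ℝ) : (MeasurableEquiv.piFinSuccAbove (fun _ : Fin (M + 1) => ℝ) n).symm
      (t, y) = Fin.insertNth n t y := rfl
  simp only [hins, Pi.zero_apply]
  set r := 1 - ∑ i, y i with hrdef
  by_cases hy : (∀ i, 0 < y i) ∧ 0 < r
  · have hmem (t : ℝ) : n.insertNth t y ∈ openSimplex (M + 1) 1 ↔ t ∈ Set.Ioo 0 r := by
      rw [insertNth_mem_openSimplex]
      refine and_congr_right fun _ => ?_
      simp only [openSimplex, Set.mem_ofPred_eq, hy.1, implies_true, true_and, hrdef]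
      constructor <;> intro h <;> linarith
    have key := setIntegral_weight_deriv_eq_zero (hα n.castSucc) (hα (Fin.last (M + 1))) hy.2
      (fun t => hasDerivAt_insertNth hu n y t)
      (hpd.comp (Continuous.finInsertNth (A := fun _ => ℝ) n continuous_id continuous_const))
    rw [← integral_indicator measurableSet_Ioo] at key
    rw [← mul_zero (dirichletConst α * ∏ i, y i ^ (α (n.succAbove i).castSucc - 1)), ← key,
      ← integral_const_mul]
    refine integral_congr_ae (Eventually.of_forall fun t => ?_)
    by_cases ht : t ∈ Set.Ioo 0 r
    · simp only
      rw [Set.indicator_of_mem ht, Set.indicator_of_mem ((hmem t).2 ht),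
        dirichletDensity_of_mem ((hmem t).2 ht), drift, rest_eq fun i => (((hmem t).2 ht).1 i).le]
      have hs : 1 - ∑ i, (n.insertNth t y : Fin (M + 1) → ℝ) i = r - t := by
        rw [Fin.sum_univ_succAbove _ n]
        simp only [Fin.insertNth_apply_same, Fin.insertNth_apply_succAbove, hrdef]
        ring
      rw [hs, Fin.prod_univ_succAbove _ n]
      simp only [Fin.insertNth_apply_same, Fin.insertNth_apply_succAbove]
      ring
    · simp only
      rw [Set.indicator_of_notMem ht, Set.indicator_of_notMem (fun h => ht ((hmem t).1 h)),
        mul_zero]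
  · refine integral_eq_zero_of_ae (Eventually.of_forall fun t => ?_)
    refine Set.indicator_of_notMem (fun h => hy ?_) _
    obtain ⟨h1, h2, h3⟩ := insertNth_mem_openSimplex.1 h
    exact ⟨h2, by simp only [hrdef]; linarith⟩

theorem integrable_of_continuous (hα : ∀ i, 0 < α i) {h : Simplex N → ℝ} (hh : Continuous h) :
    Integrable h (dirichletMeasure α) := by
  have := isProbabilityMeasure_dirichletMeasure hα
  exact hh.integrable_of_hasCompactSupport (HasCompactSupport.of_compactSpace h)

theorem continuous_diffOp {f : (Fin N → ℝ) → ℝ} (hf : ContDiff ℝ 2 f) :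
    Continuous (diffOp α f) := by
  have h0 (n : Fin N) := continuous_pderiv (hf.of_le one_le_two) n
  have h1 (n : Fin N) := continuous_pderiv (contDiff_pderiv hf n) n
  have h2 (n : Fin N) := continuous_drift (α := α) n
  have h3 := continuous_rest (N := N)
  unfold diffOp; fun_prop

/-- `-∫ f L g dμ = E(f, g)` for `f, g` of class `C²`. -/
theorem neg_integral_mul_diffOp (hα : ∀ i, 0 < α i) {f g : (Fin N → ℝ) → ℝ} (hf : ContDiff ℝ 2 f)
    (hg : ContDiff ℝ 2 g) :
    -∫ x : Simplex N, f x * diffOp α g x ∂(dirichletMeasure α) = preForm α f g := by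
  have hf1 := hf.of_le one_le_two
  have hg1 := hg.of_le one_le_two
  have hprod (n : Fin N) (x : Fin N → ℝ) : pderiv n (fun y => f y * pderiv n g y) x =
      f x * pderiv n (pderiv n g) x + pderiv n g x * pderiv n f x := by
    have h1 := (hf1.differentiable one_ne_zero x)
    have h2 := ((contDiff_pderiv hg n).differentiable one_ne_zero x)
    rw [pderiv, fderiv_fun_mul h1 h2]
    simp [pderiv]
  have hr := continuous_rest (N := N)
  have hcf (n : Fin N) := continuous_pderiv hf1 n
  have hcg (n : Fin N) := continuous_pderiv hg1 n
  have hcL := continuous_diffOp (α := α) hg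
  have hcd (n : Fin N) := continuous_drift (α := α) n
  have hc0 := hf.continuous
  have hc2 (n : Fin N) := continuous_pderiv (contDiff_pderiv hg n) n
  have hsum : ∑ n : Fin N, ∫ x : Simplex N, (x.1 n * rest x.1 *
      pderiv n (fun y => f y * pderiv n g y) x + drift α n x * (f x * pderiv n g x))
        ∂(dirichletMeasure α) = 0 :=
    Finset.sum_eq_zero fun n _ =>
      integral_divergence_eq_zero hα (hf1.mul (contDiff_pderiv hg n)) n
  rw [← integral_finsetSum] at hsum
  · rw [preForm, neg_eq_iff_add_eq_zero, ← integral_add, ← hsum]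
    · refine integral_congr_ae (Eventually.of_forall fun x => ?_)
      simp only [diffOp, Finset.mul_sum, ← Finset.sum_add_distrib, hprod]
      refine Finset.sum_congr rfl fun n _ => ?_
      ring
    · exact integrable_of_continuous hα ((hc0.mul hcL).comp continuous_subtype_val)
    · have h : Continuous fun x => rest x * ∑ n, x n * (pderiv n f x * pderiv n g x) := by fun_prop
      exact integrable_of_continuous hα (h.comp continuous_subtype_val)
  · intro n _
    simp only [hprod]
    have h : Continuous fun x => x n * rest x * (f x * pderiv n (pderiv n g) x +
        pderiv n g x * pderiv n f x) + drift α n x * (f x * pderiv n g x) := by fun_prop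
    exact integrable_of_continuous hα (h.comp continuous_subtype_val)

theorem preForm_comm (f g : (Fin N → ℝ) → ℝ) : preForm α f g = preForm α g f := by
  simp only [preForm, mul_comm (pderiv _ f _)]

theorem integral_mul_diffOp_comm (hα : ∀ i, 0 < α i) {f g : (Fin N → ℝ) → ℝ}
    (hf : ContDiff ℝ 2 f) (hg : ContDiff ℝ 2 g) :
    ∫ x : Simplex N, f x * diffOp α g x ∂(dirichletMeasure α) =
      ∫ x : Simplex N, g x * diffOp α f x ∂(dirichletMeasure α) := by
  rw [← neg_inj, neg_integral_mul_diffOp hα hf hg, neg_integral_mul_diffOp hα hg hf, preForm_comm]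

theorem preForm_self_nonneg (f : (Fin N → ℝ) → ℝ) : 0 ≤ preForm α f f := by
  refine integral_nonneg fun x => mul_nonneg ?_ (Finset.sum_nonneg fun n _ =>
    mul_nonneg (x.2.1 n).1 (mul_self_nonneg _))
  rw [rest_eq fun i => (x.2.1 i).1]
  linarith [x.2.2]

/-! ### Polynomials in `L²` of the Dirichlet distribution -/

theorem contDiff_eval (p : MvPolynomial (Fin N) ℝ) {n : WithTop ℕ∞} :
    ContDiff ℝ n fun x : Fin N → ℝ => MvPolynomial.eval x p :=
  (AnalyticOnNhd.eval_mvPolynomial p).contDiff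

theorem pderiv_eval (n : Fin N) (p : MvPolynomial (Fin N) ℝ) :
    pderiv n (fun x => MvPolynomial.eval x p) =
      fun x => MvPolynomial.eval x (MvPolynomial.pderiv n p) := by
  have hd (q : MvPolynomial (Fin N) ℝ) (x : Fin N → ℝ) :
      DifferentiableAt ℝ (fun x : Fin N → ℝ => MvPolynomial.eval x q) x :=
    (contDiff_eval (n := 1) q).differentiable one_ne_zero x
  induction p using MvPolynomial.induction_on with
  | C a => ext x; simp [pderiv]
  | add p q hp hq =>
    ext x
    have hp' := congrFun hp x
    have hq' := congrFun hq x
    simp only [pderiv] at hp' hq' ⊢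
    simp only [map_add]
    rw [fderiv_fun_add (hd p x) (hd q x), add_apply, hp', hq']
  | mul_X p i hp =>
    ext x
    have hp' := congrFun hp x
    simp only [pderiv] at hp' ⊢
    simp only [map_mul, MvPolynomial.eval_X]
    have hi : HasFDerivAt (fun x : Fin N → ℝ => x i)
        (ContinuousLinearMap.proj (R := ℝ) (φ := fun _ : Fin N => ℝ) i) x :=
      ContinuousLinearMap.hasFDerivAt
        (ContinuousLinearMap.proj (R := ℝ) (φ := fun _ : Fin N => ℝ) i)
    rw [fderiv_fun_mul (hd p x) hi.differentiableAt, hi.fderiv]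
    simp only [add_apply, smul_apply,
      ContinuousLinearMap.proj_apply, smul_eq_mul, hp', MvPolynomial.pderiv_mul,
      MvPolynomial.pderiv_X, map_add, map_mul, MvPolynomial.eval_X]
    by_cases h : n = i
    · subst h; simp; ring
    · simp [Ne.symm h]; ring

theorem diffOp_eval (p : MvPolynomial (Fin N) ℝ) (x : Simplex N) :
    diffOp α (fun x => MvPolynomial.eval x p) x = MvPolynomial.eval x.1 (polyOp α p) := by
  simp only [diffOp, pderiv_eval, polyOp_apply, lowerOp_apply, eulerOp_apply, drift,
    rest_eq fun i => (x.2.1 i).1]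
  simp only [map_sub, map_mul, map_sum, map_add, MvPolynomial.eval_X, MvPolynomial.smul_eval]
  rw [← one_sub_mul, Finset.mul_sum, Finset.mul_sum, ← Finset.sum_sub_distrib]
  refine Finset.sum_congr rfl fun n _ => ?_
  ring

section L2

theorem memLp_of_continuous (hα : ∀ i, 0 < α i) {h : Simplex N → ℝ} (hh : Continuous h) :
    MemLp h 2 (dirichletMeasure α) := by
  have := isProbabilityMeasure_dirichletMeasure hα
  exact hh.memLp_of_hasCompactSupport (HasCompactSupport.of_compactSpace h)

theorem inner_toLp {X : Type*} [MeasurableSpace X] {μ : Measure X} {f g : X → ℝ}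
    (hf : MemLp f 2 μ) (hg : MemLp g 2 μ) :
    inner ℝ (hf.toLp f) (hg.toLp g) = ∫ x, f x * g x ∂μ := by
  rw [L2.inner_def]
  refine integral_congr_ae ?_
  filter_upwards [hf.coeFn_toLp, hg.coeFn_toLp] with x h1 h2
  rw [h1, h2]
  simp [mul_comm]

theorem continuous_eval_simplex (p : MvPolynomial (Fin N) ℝ) :
    Continuous fun x : Simplex N => MvPolynomial.eval x.1 p :=
  (MvPolynomial.continuous_eval p).comp continuous_subtype_val

/-- The `L²`-class of a polynomial, as a linear map. -/
def polyLp (hα : ∀ i, 0 < α i) : MvPolynomial (Fin N) ℝ →ₗ[ℝ] Lp ℝ 2 (dirichletMeasure α) where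
  toFun p := (memLp_of_continuous hα (continuous_eval_simplex p)).toLp _
  map_add' p q := by
    rw [← MemLp.toLp_add]
    congr 1
    ext x; simp
  map_smul' c p := by
    rw [RingHom.id_apply, ← MemLp.toLp_const_smul]
    congr 1
    ext x; simp

theorem polyLp_apply (hα : ∀ i, 0 < α i) (p : MvPolynomial (Fin N) ℝ) :
    polyLp hα p = (memLp_of_continuous hα (continuous_eval_simplex p)).toLp _ := rfl

theorem inner_polyLp (hα : ∀ i, 0 < α i) (p q : MvPolynomial (Fin N) ℝ) :
    inner ℝ (polyLp hα p) (polyLp hα q) = ∫ x : Simplex N,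
      MvPolynomial.eval x.1 p * MvPolynomial.eval x.1 q ∂(dirichletMeasure α) :=
  inner_toLp (memLp_of_continuous hα (continuous_eval_simplex p))
    (memLp_of_continuous hα (continuous_eval_simplex q))

theorem polyLp_injective (hα : ∀ i, 0 < α i) : Function.Injective (polyLp hα) := by
  rw [injective_iff_map_eq_zero]
  intro p hp
  refine polynomial_eq_zero_of_ae_eq_zero hα ?_
  have h := MemLp.coeFn_toLp (memLp_of_continuous hα (continuous_eval_simplex p))
  rw [← polyLp_apply hα, hp] at h
  filter_upwards [h, Lp.coeFn_zero ℝ 2 (dirichletMeasure α)] with x h1 h2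
  rw [← h1, h2, Pi.zero_apply]

/-- `L` on polynomials is symmetric in `L²`. -/
theorem inner_polyLp_polyOp (hα : ∀ i, 0 < α i) (p q : MvPolynomial (Fin N) ℝ) :
    inner ℝ (polyLp hα (polyOp α p)) (polyLp hα q) =
      inner ℝ (polyLp hα p) (polyLp hα (polyOp α q)) := by
  have h := integral_mul_diffOp_comm hα (contDiff_eval q) (contDiff_eval p)
  simp only [diffOp_eval] at h
  rw [inner_polyLp, inner_polyLp, ← h]
  simp only [mul_comm]

/-- Polynomials as continuous functions on the simplex. -/
def polyC (N : ℕ) : MvPolynomial (Fin N) ℝ →ₐ[ℝ] C(Simplex N, ℝ) :=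
  MvPolynomial.aeval fun i => ⟨fun x => x.1 i, (continuous_apply i).comp continuous_subtype_val⟩

theorem polyC_apply (p : MvPolynomial (Fin N) ℝ) (x : Simplex N) :
    polyC N p x = MvPolynomial.eval x.1 p := by
  induction p using MvPolynomial.induction_on with
  | C a => simp [polyC]
  | add p q hp hq => simp [hp, hq]
  | mul_X p i hp =>
    rw [map_mul, ContinuousMap.mul_apply, hp, map_mul, MvPolynomial.eval_X]
    simp [polyC]

/-- Polynomials are uniformly dense, by the Stone–Weierstrass theorem. -/
theorem denseRange_polyC (N : ℕ) : DenseRange (polyC N) := by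
  have h := ContinuousMap.subalgebra_topologicalClosure_eq_top_of_separatesPoints (polyC N).range ?_
  · intro f
    have : f ∈ (polyC N).range.topologicalClosure := h ▸ Algebra.mem_top
    exact this
  · intro x y hxy
    obtain ⟨i, hi⟩ : ∃ i, x.1 i ≠ y.1 i := by
      by_contra! h
      exact hxy (Subtype.ext (funext h))
    exact ⟨_, ⟨_, ⟨MvPolynomial.X i, rfl⟩, rfl⟩, by simpa [polyC] using hi⟩

theorem denseRange_polyLp (hα : ∀ i, 0 < α i) : DenseRange (polyLp hα) := by
  have := isProbabilityMeasure_dirichletMeasure hα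
  have hd := (ContinuousMap.toLp_denseRange ℝ (dirichletMeasure α) ℝ (p := 2) (by norm_num)).comp
    (denseRange_polyC N) (ContinuousMap.toLp 2 (dirichletMeasure α) ℝ).continuous
  convert hd using 1
  ext1 p
  refine Lp.ext ?_
  filter_upwards [MemLp.coeFn_toLp (memLp_of_continuous hα (continuous_eval_simplex p)),
    ContinuousMap.coeFn_toLp (p := 2) (dirichletMeasure α) (𝕜 := ℝ) (polyC N p)] with x h1 h2
  rw [polyLp_apply, h1, Function.comp_apply, h2, polyC_apply]

/-- The space of the `L²`-classes of polynomials of degree at most `d`. -/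
def polySpace (hα : ∀ i, 0 < α i) (d : ℕ) : Submodule ℝ (Lp ℝ 2 (dirichletMeasure α)) :=
  (MvPolynomial.restrictTotalDegree (Fin N) ℝ d).map (polyLp hα)

instance (hα : ∀ i, 0 < α i) (d : ℕ) : FiniteDimensional ℝ (polySpace hα d) := by
  unfold polySpace; infer_instance

/-- Every polynomial is a finite sum of pairwise orthogonal polynomial eigenvectors of `-L`. The
eigenvalues are at least `α_{N+1}`, except for constant eigenvectors, which have eigenvalue `0`. -/
theorem exists_eigenvector_decomposition (hα : ∀ i, 0 < α i) (p : MvPolynomial (Fin N) ℝ) :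
    ∃ (n : ℕ) (φ : Fin n → MvPolynomial (Fin N) ℝ) (c : Fin n → ℝ), p = ∑ i, φ i ∧
      (∀ i, polyOp α (φ i) = -c i • φ i) ∧
      (∀ i j, i ≠ j → inner ℝ (polyLp hα (φ i)) (polyLp hα (φ j)) = 0) ∧
      ∀ i, ((∃ a, φ i = MvPolynomial.C a) ∧ c i = 0) ∨ α (Fin.last N) ≤ c i := by
  set V := MvPolynomial.restrictTotalDegree (Fin N) ℝ p.totalDegree with hV
  set W := polySpace hα p.totalDegree with hW
  let e : V ≃ₗ[ℝ] W := Submodule.equivMapOfInjective (polyLp hα) (polyLp_injective hα) V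
  have he (q : V) : (e q : Lp ℝ 2 (dirichletMeasure α)) = polyLp hα q := rfl
  let S : V →ₗ[ℝ] V := (polyOp α).restrict fun q hq => by
    rw [hV, MvPolynomial.mem_restrictTotalDegree] at hq ⊢
    exact totalDegree_polyOp_le α hq
  have hS (q : V) : (S q : MvPolynomial (Fin N) ℝ) = polyOp α q := rfl
  let T : W →ₗ[ℝ] W := e.toLinearMap ∘ₗ S ∘ₗ e.symm.toLinearMap
  have hT : T.IsSymmetric := by
    intro x y
    obtain ⟨q, rfl⟩ := e.surjective x
    obtain ⟨q', rfl⟩ := e.surjective y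
    simp only [T, LinearMap.comp_apply, LinearEquiv.coe_coe, LinearEquiv.symm_apply_apply,
      Submodule.coe_inner, he, hS]
    exact inner_polyLp_polyOp hα _ _
  let b := hT.eigenvectorBasis rfl
  let ψ : Fin (Module.finrank ℝ W) → MvPolynomial (Fin N) ℝ := fun i => (e.symm (b i)).1
  have hψ0 (i) : ψ i ≠ 0 := fun h => by
    have h1 : e.symm (b i) = 0 := Subtype.ext h
    exact b.orthonormal.ne_zero i ((LinearEquiv.map_eq_zero_iff _).1 h1)
  have hψb (i) : polyLp hα (ψ i) = b i := by
    rw [← he, LinearEquiv.apply_symm_apply]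
  have hψ (i) : polyOp α (ψ i) = hT.eigenvalues rfl i • ψ i := by
    have h : T (b i) = hT.eigenvalues rfl i • b i := hT.apply_eigenvectorBasis rfl i
    have h2 : e.symm (T (b i)) = S (e.symm (b i)) := by
      simp only [T, LinearMap.comp_apply, LinearEquiv.coe_coe, LinearEquiv.symm_apply_apply]
    rw [← hS, ← h2, h, map_smul, Submodule.coe_smul]
  let ep : W := e ⟨p, by rw [hV, MvPolynomial.mem_restrictTotalDegree]⟩
  refine ⟨_, fun i => inner ℝ (b i) ep • ψ i, fun i => -hT.eigenvalues rfl i, ?_, fun i => ?_,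
    fun i j hij => ?_, fun i => ?_⟩
  · have h := congrArg (fun w => (e.symm w).1) (b.sum_repr' ep)
    simp only [map_sum, map_smul, ep, LinearEquiv.symm_apply_apply, Submodule.coe_sum,
      Submodule.coe_smul] at h
    exact h.symm
  · rw [map_smul, hψ, neg_neg, smul_comm]
  · rw [map_smul, map_smul, hψb, hψb, inner_smul_left, inner_smul_right, ← Submodule.coe_inner,
      b.orthonormal.2 hij, mul_zero, mul_zero]
  · by_cases hd : (ψ i).totalDegree = 0
    · left
      have h1 := MvPolynomial.totalDegree_eq_zero_iff_eq_C.1 hd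
      refine ⟨⟨inner ℝ (b i) ep * MvPolynomial.coeff 0 (ψ i), ?_⟩, ?_⟩
      · rw [map_mul, ← h1, ← MvPolynomial.smul_eq_C_mul]
      · have h2 := hψ i
        rw [h1, polyOp_apply, lowerOp_apply, eulerOp_apply] at h2
        simp only [MvPolynomial.pderiv_C, map_zero, mul_zero, smul_zero, add_zero,
          Finset.sum_const_zero, sub_zero] at h2
        rw [← h1] at h2
        exact neg_eq_zero.2 ((smul_eq_zero.1 h2.symm).resolve_right (hψ0 i))
    · right
      exact le_eigenvalue_of_totalDegree_pos α hα hd (by rw [neg_neg]; exact hψ i)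

/-- A polynomial eigenvector of `L` with nonzero eigenvalue has mean zero. -/
theorem inner_polyLp_one_eq_zero (hα : ∀ i, 0 < α i) {φ : MvPolynomial (Fin N) ℝ} {c : ℝ}
    (hc : c ≠ 0) (h : polyOp α φ = -c • φ) : inner ℝ (polyLp hα 1) (polyLp hα φ) = 0 := by
  have h1 := inner_polyLp_polyOp hα 1 φ
  have h2 : polyOp α 1 = 0 := by simp [polyOp_apply, lowerOp_apply, eulerOp_apply]
  rw [h2, h, map_zero, inner_zero_left, map_smul, inner_smul_right] at h1
  exact (mul_eq_zero.1 h1.symm).resolve_left (neg_ne_zero.2 hc)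

/-- The eigenvector decomposition of a polynomial, with the constant part separated. -/
theorem exists_const_add_eigenvector_decomposition (hα : ∀ i, 0 < α i)
    (p : MvPolynomial (Fin N) ℝ) :
    ∃ (a : ℝ) (n : ℕ) (φ : Fin n → MvPolynomial (Fin N) ℝ) (c : Fin n → ℝ),
      p = a • 1 + ∑ i, φ i ∧ (∀ i, polyOp α (φ i) = -c i • φ i) ∧
      (∀ i j, i ≠ j → inner ℝ (polyLp hα (φ i)) (polyLp hα (φ j)) = 0) ∧
      (∀ i, α (Fin.last N) ≤ c i) ∧ ∀ i, inner ℝ (polyLp hα 1) (polyLp hα (φ i)) = 0 := by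
  classical
  obtain ⟨n, φ, c, hp, hφ, horth, hc⟩ := exists_eigenvector_decomposition hα p
  let P : Fin n → Prop := fun i => α (Fin.last N) ≤ c i
  have hconst (i) : ∃ a : ℝ, ¬ P i → φ i = a • 1 := by
    rcases hc i with ⟨⟨a, ha⟩, -⟩ | h
    · exact ⟨a, fun _ => by rw [ha, MvPolynomial.smul_eq_C_mul, mul_one]⟩
    · exact ⟨0, fun h' => absurd h h'⟩
  choose a ha using hconst
  refine ⟨∑ i, if P i then 0 else a i, n, fun i => if P i then φ i else 0,
    fun i => if P i then c i else α (Fin.last N), ?_, fun i => ?_, fun i j hij => ?_, fun i => ?_,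
    fun i => ?_⟩
  · rw [hp, Finset.sum_smul, ← Finset.sum_add_distrib]
    refine Finset.sum_congr rfl fun i _ => ?_
    by_cases h : P i
    · simp [h]
    · simp [h, ← ha i h]
  · by_cases h : P i
    · simp [h, hφ i]
    · simp [h]
  · by_cases h : P i <;> by_cases h' : P j <;> simp [h, h', horth i j hij]
  · by_cases h : P i
    · simp only [if_pos h]; exact h
    · simp only [if_neg h]; exact le_rfl
  · by_cases h : P i
    · simpa [h] using inner_polyLp_one_eq_zero hα ((hα _).trans_le h).ne' (hφ i)
    · simp [h]

/-- The orthogonal projections of an element of `L²` to the polynomials of degree at most `k`. -/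
theorem exists_polynomial_projections (hα : ∀ i, 0 < α i) (u : Lp ℝ 2 (dirichletMeasure α)) :
    ∃ p : ℕ → MvPolynomial (Fin N) ℝ, Tendsto (fun k => polyLp hα (p k)) atTop (𝓝 u) ∧
      (∀ k, (p k).totalDegree ≤ k) ∧
      ∀ k q, q.totalDegree ≤ k →
        inner ℝ (polyLp hα (p k)) (polyLp hα q) = inner ℝ u (polyLp hα q) := by
  have hmem (k : ℕ) : (polySpace hα k).starProjection u ∈ polySpace hα k :=
    Submodule.starProjection_apply_mem _ _
  choose p hp hpu using hmem
  refine ⟨p, ?_, fun k => ?_, fun k q hq => ?_⟩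
  · simp only [hpu]
    refine Submodule.starProjection_tendsto_self (polySpace hα) (fun k l hkl => ?_) u ?_
    · refine Submodule.map_mono fun q hq => ?_
      rw [MvPolynomial.mem_restrictTotalDegree] at hq ⊢
      exact hq.trans hkl
    · intro w _
      rw [← SetLike.mem_coe, Submodule.topologicalClosure_coe]
      refine closure_mono ?_ (denseRange_polyLp hα w)
      rintro _ ⟨q, rfl⟩
      exact Submodule.mem_iSup_of_mem q.totalDegree
        ⟨q, (MvPolynomial.mem_restrictTotalDegree _ _ _).2 le_rfl, rfl⟩
  · exact (MvPolynomial.mem_restrictTotalDegree _ _ _).1 (hp k)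
  · rw [hpu]
    have := Submodule.starProjection_inner_eq_zero (K := polySpace hα k) u (polyLp hα q)
      ⟨q, (MvPolynomial.mem_restrictTotalDegree _ _ _).2 hq, rfl⟩
    rw [inner_sub_left, sub_eq_zero] at this
    exact this.symm

end L2

/-! ### The closed form and the Poincaré inequality -/

theorem tendstoL2_iff {ι : Type} {l : Filter ι} {f : ι → Simplex N → ℝ} {u : Simplex N → ℝ}
    (hf : ∀ k, MemLp (f k) 2 (dirichletMeasure α)) (hu : MemLp u 2 (dirichletMeasure α)) :
    TendstoL2 α f l u ↔ Tendsto (fun k => (hf k).toLp (f k)) l (𝓝 (hu.toLp u)) :=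
  (Lp.tendsto_Lp_iff_tendsto_eLpNorm'' f hf u hu).symm

theorem inner_sum_sum_of_orthogonal {E : Type*} [NormedAddCommGroup E] [InnerProductSpace ℝ E]
    {ι : Type*} [Fintype ι] {v : ι → E} (hv : ∀ i j, i ≠ j → inner ℝ (v i) (v j) = 0)
    (a b : ι → ℝ) :
    inner ℝ (∑ i, a i • v i) (∑ i, b i • v i) = ∑ i, a i * b i * ‖v i‖ ^ 2 := by
  rw [sum_inner]
  refine Finset.sum_congr rfl fun i _ => ?_
  rw [inner_sum, Finset.sum_eq_single i]
  · rw [inner_smul_left, inner_smul_right, real_inner_self_eq_norm_sq]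
    simp [mul_assoc]
  · intro j _ hj
    rw [inner_smul_left, inner_smul_right, hv i j hj.symm, mul_zero, mul_zero]
  · simp

theorem norm_polyLp_one (hα : ∀ i, 0 < α i) : ‖polyLp hα 1‖ = 1 := by
  have := isProbabilityMeasure_dirichletMeasure hα
  have h : ‖polyLp hα 1‖ ^ 2 = 1 := by
    rw [← real_inner_self_eq_norm_sq, inner_polyLp]; simp
  rwa [pow_eq_one_iff_of_nonneg (norm_nonneg _) two_ne_zero] at h

theorem inner_polyLp_one (hα : ∀ i, 0 < α i) {u : Simplex N → ℝ}
    (hu : MemLp u 2 (dirichletMeasure α)) :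
    inner ℝ (polyLp hα 1) (hu.toLp u) = ∫ x, u x ∂(dirichletMeasure α) := by
  rw [polyLp_apply, inner_toLp]; simp

/-- The Poincaré inequality for polynomials, by expansion in eigenvectors. -/
theorem poincare_polynomial (hα : ∀ i, 0 < α i) (p : MvPolynomial (Fin N) ℝ) :
    α (Fin.last N) * (‖polyLp hα p‖ ^ 2 - inner ℝ (polyLp hα 1) (polyLp hα p) ^ 2) ≤
      -inner ℝ (polyLp hα p) (polyLp hα (polyOp α p)) := by
  obtain ⟨a, n, φ, c, rfl, hφ, horth, hc, h1⟩ := exists_const_add_eigenvector_decomposition hα p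
  have h2 : polyOp α 1 = 0 := by simp [polyOp_apply, lowerOp_apply, eulerOp_apply]
  have hsum : polyLp hα (∑ i, φ i) = ∑ i, (1 : ℝ) • polyLp hα (φ i) := by simp
  have h3 : inner ℝ (polyLp hα 1) (polyLp hα (∑ i, φ i)) = 0 := by
    rw [map_sum, inner_sum]; exact Finset.sum_eq_zero fun i _ => h1 i
  have hL : polyLp hα (polyOp α (a • 1 + ∑ i, φ i)) = ∑ i, -c i • polyLp hα (φ i) := by
    rw [map_add, map_smul, h2, smul_zero, zero_add, map_sum, map_sum]
    exact Finset.sum_congr rfl fun i _ => by rw [hφ, map_smul]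
  have hn : inner ℝ (polyLp hα 1) (polyLp hα 1) = 1 := by
    rw [real_inner_self_eq_norm_sq, norm_polyLp_one, one_pow]
  rw [hL, map_add, map_smul, inner_add_left, inner_smul_left, inner_sum]
  simp only [inner_smul_right, h1, mul_zero, Finset.sum_const_zero, zero_add]
  rw [inner_add_right, inner_smul_right, hn, h3, ← real_inner_self_eq_norm_sq, inner_add_add_self,
    inner_smul_left, inner_smul_right, inner_smul_left, inner_smul_right, hn, h3,
    real_inner_comm, h3, hsum, inner_sum_sum_of_orthogonal horth, inner_sum_sum_of_orthogonal horth]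
  rw [← Finset.sum_neg_distrib]
  simp only [conj_trivial, mul_one, mul_zero, add_zero, one_mul]
  rw [← sq, add_sub_cancel_left, Finset.mul_sum]
  refine Finset.sum_le_sum fun i _ => ?_
  rw [neg_mul, neg_neg]
  exact mul_le_mul_of_nonneg_right (hc i) (sq_nonneg _)

theorem preForm_sub_left (hα : ∀ i, 0 < α i) {f g h : (Fin N → ℝ) → ℝ} (hf : ContDiff ℝ 2 f)
    (hg : ContDiff ℝ 2 g) (hh : ContDiff ℝ 2 h) :
    preForm α (f - g) h = preForm α f h - preForm α g h := by
  have hf1 := hf.of_le one_le_two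
  have hg1 := hg.of_le one_le_two
  have hsub (n : Fin N) (x : Fin N → ℝ) : pderiv n (f - g) x = pderiv n f x - pderiv n g x := by
    rw [pderiv, fderiv_sub (hf1.differentiable one_ne_zero x) (hg1.differentiable one_ne_zero x)]
    rfl
  have hr := continuous_rest (N := N)
  have hcf (n : Fin N) := continuous_pderiv hf1 n
  have hcg (n : Fin N) := continuous_pderiv hg1 n
  have hch (n : Fin N) := continuous_pderiv (hh.of_le one_le_two) n
  have h1 : Continuous fun x => rest x * ∑ n, x n * (pderiv n f x * pderiv n h x) := by fun_prop
  have h2 : Continuous fun x => rest x * ∑ n, x n * (pderiv n g x * pderiv n h x) := by fun_prop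
  have h1' : Integrable (fun x : Simplex N => rest x.1 * ∑ n, x.1 n * (pderiv n f x * pderiv n h x))
      (dirichletMeasure α) := integrable_of_continuous hα (h1.comp continuous_subtype_val)
  have h2' : Integrable (fun x : Simplex N => rest x.1 * ∑ n, x.1 n * (pderiv n g x * pderiv n h x))
      (dirichletMeasure α) := integrable_of_continuous hα (h2.comp continuous_subtype_val)
  rw [preForm, preForm, preForm, ← integral_sub h1' h2']
  refine integral_congr_ae (Eventually.of_forall fun x => ?_)
  simp only [hsub, sub_mul, mul_sub, Finset.sum_sub_distrib]

theorem preForm_sub_self (hα : ∀ i, 0 < α i) {f g : (Fin N → ℝ) → ℝ} (hf : ContDiff ℝ 2 f)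
    (hg : ContDiff ℝ 2 g) :
    preForm α (f - g) (f - g) = preForm α f f - 2 * preForm α f g + preForm α g g := by
  have hfg : ContDiff ℝ 2 (f - g) := hf.sub hg
  rw [preForm_sub_left hα hf hg hfg, preForm_comm f, preForm_comm g,
    preForm_sub_left hα hf hg hf, preForm_sub_left hα hf hg hg, preForm_comm g f]
  ring

theorem memLp_of_contDiff (hα : ∀ i, 0 < α i) {f : (Fin N → ℝ) → ℝ} (hf : ContDiff ℝ 2 f) :
    MemLp (fun x : Simplex N => f x) 2 (dirichletMeasure α) :=
  memLp_of_continuous hα (hf.continuous.comp continuous_subtype_val)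

theorem memLp_diffOp (hα : ∀ i, 0 < α i) {f : (Fin N → ℝ) → ℝ} (hf : ContDiff ℝ 2 f) :
    MemLp (fun x : Simplex N => diffOp α f x) 2 (dirichletMeasure α) :=
  memLp_of_continuous hα ((continuous_diffOp hf).comp continuous_subtype_val)

theorem preForm_eq_neg_inner (hα : ∀ i, 0 < α i) {f g : (Fin N → ℝ) → ℝ} (hf : ContDiff ℝ 2 f)
    (hg : ContDiff ℝ 2 g) :
    preForm α f g = -inner ℝ ((memLp_of_contDiff hα hf).toLp _) ((memLp_diffOp hα hg).toLp _) := by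
  rw [inner_toLp, neg_integral_mul_diffOp hα hf hg]

theorem toLp_diffOp_eval (hα : ∀ i, 0 < α i) (p : MvPolynomial (Fin N) ℝ) :
    (memLp_diffOp hα (contDiff_eval p)).toLp _ = polyLp hα (polyOp α p) := by
  rw [polyLp_apply]
  congr 1
  ext x
  exact diffOp_eval p x

theorem toLp_eval (hα : ∀ i, 0 < α i) (p : MvPolynomial (Fin N) ℝ) :
    (memLp_of_contDiff hα (contDiff_eval p)).toLp _ = polyLp hα p := rfl

/-- The Poincaré inequality for `C²` functions: by symmetry of `L`, the energy of `f` is at least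
that of its orthogonal projection to the polynomials of degree at most `k`, for every `k`. -/
theorem poincare_contDiff (hα : ∀ i, 0 < α i) {f : (Fin N → ℝ) → ℝ} (hf : ContDiff ℝ 2 f) :
    α (Fin.last N) * (‖(memLp_of_contDiff hα hf).toLp _‖ ^ 2 -
      inner ℝ (polyLp hα 1) ((memLp_of_contDiff hα hf).toLp _) ^ 2) ≤ preForm α f f := by
  set u := (memLp_of_contDiff hα hf).toLp _ with hu
  obtain ⟨p, hlim, hdeg, hp⟩ := exists_polynomial_projections hα u
  -- expand `0 ≤ E(f - p_k, f - p_k)`, where `E(f, p_k) = -⟨f, L p_k⟩ = -⟨p_k, L p_k⟩`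
  refine le_of_tendsto (((hlim.norm.pow 2).sub ((tendsto_const_nhds.inner hlim).pow 2)).const_mul
    (α (Fin.last N))) (Eventually.of_forall fun k => (poincare_polynomial hα (p k)).trans ?_)
  have hq := contDiff_eval (p k) (n := 2)
  have h0 := preForm_self_nonneg (α := α) (f - fun x => MvPolynomial.eval x (p k))
  rw [preForm_sub_self hα hf hq, preForm_eq_neg_inner hα hf hq, preForm_eq_neg_inner hα hq hq,
    toLp_diffOp_eval hα, ← hu, ← hp k _ (totalDegree_polyOp_le α (hdeg k)), toLp_eval hα] at h0
  linarith

/-- The Poincaré inequality on the domain of the closure of the form. -/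
theorem poincare_of_isFormValue (hα : ∀ i, 0 < α i) {u : Simplex N → ℝ} {e : ℝ}
    (h : IsFormValue α u e) :
    α (Fin.last N) * (∫ x, u x ^ 2 ∂(dirichletMeasure α) -
      (∫ x, u x ∂(dirichletMeasure α)) ^ 2) ≤ e := by
  obtain ⟨hu, f, hf, he⟩ := h
  have hlim := (tendstoL2_iff (fun k => memLp_of_contDiff hα (hf.contDiff k)) hu).1 hf.tendsto
  have h1 : ∫ x, u x ^ 2 ∂(dirichletMeasure α) = ‖hu.toLp u‖ ^ 2 := by
    rw [← real_inner_self_eq_norm_sq, inner_toLp]; simp only [sq]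
  rw [h1, ← inner_polyLp_one hα hu]
  exact le_of_tendsto_of_tendsto' (((hlim.norm.pow 2).sub
    ((tendsto_const_nhds.inner hlim).pow 2)).const_mul (α (Fin.last N))) he
    fun k => poincare_contDiff hα (hf.contDiff k)

theorem formClosable (hα : ∀ i, 0 < α i) : FormClosable α := by
  intro f hf
  have hlim := (tendstoL2_iff (fun k => memLp_of_contDiff hα (hf.contDiff k))
    MemLp.zero).1 hf.tendsto
  rw [show (MemLp.zero : MemLp (fun _ : Simplex N => (0 : ℝ)) 2 (dirichletMeasure α)).toLp _ = 0
    from MemLp.toLp_zero _] at hlim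
  rw [Metric.tendsto_atTop]
  intro ε hε
  obtain ⟨⟨K₁, K₂⟩, hK⟩ := Metric.tendsto_atTop.1 hf.cauchy (ε / 2) (half_pos hε)
  refine ⟨max K₁ K₂, fun m hm => ?_⟩
  rw [Real.dist_eq, sub_zero, abs_of_nonneg (preForm_self_nonneg _)]
  refine lt_of_le_of_lt ?_ (half_lt_self hε)
  -- `E(f_m, f_n) = -⟨f_n, L f_m⟩` tends to zero as `n → ∞`
  have h1 : Tendsto (fun n => preForm α (f m) (f m) - 2 * preForm α (f m) (f n)) atTop
      (𝓝 (preForm α (f m) (f m) - 2 * 0)) := by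
    refine (Tendsto.const_mul 2 ?_).const_sub _
    have h2 (n : ℕ) : preForm α (f m) (f n) = -inner ℝ ((memLp_of_contDiff hα
        (hf.contDiff n)).toLp _) ((memLp_diffOp hα (hf.contDiff m)).toLp _) := by
      rw [preForm_comm, preForm_eq_neg_inner hα (hf.contDiff n) (hf.contDiff m)]
    simp only [h2]
    have h3 := (Tendsto.inner (𝕜 := ℝ) hlim (tendsto_const_nhds
      (x := (memLp_diffOp hα (hf.contDiff m)).toLp _))).neg
    rwa [inner_zero_left, neg_zero] at h3
  rw [mul_zero, sub_zero] at h1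
  refine le_of_tendsto h1 ?_
  filter_upwards [eventually_ge_atTop (max K₁ K₂)] with n hn
  have h3 := hK (m, n) ⟨(le_max_left _ _).trans hm, (le_max_right _ _).trans hn⟩
  rw [Real.dist_eq, sub_zero, preForm_sub_self hα (hf.contDiff m) (hf.contDiff n)] at h3
  have h4 := preForm_self_nonneg (α := α) (f n)
  linarith [le_abs_self (preForm α (f m) (f m) - 2 * preForm α (f m) (f n) +
    preForm α (f n) (f n))]

/-- `L` has a linear eigenfunction `x_0 / α_0 - x_1 / α_1` with eigenvalue `-α_{N+1}`. It is here
that at least two coordinates are needed. -/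
theorem exists_eigenvector_last (hN : 2 ≤ N) (hα : ∀ i, 0 < α i) :
    ∃ w : MvPolynomial (Fin N) ℝ, w ≠ 0 ∧ polyOp α w = -α (Fin.last N) • w := by
  let i : Fin N := ⟨0, by omega⟩
  let j : Fin N := ⟨1, by omega⟩
  have hij : i ≠ j := by simp [i, j]
  have hi := (hα i.castSucc).ne'
  have hj := (hα j.castSucc).ne'
  refine ⟨(α i.castSucc)⁻¹ • MvPolynomial.X i - (α j.castSucc)⁻¹ • MvPolynomial.X j, fun h => ?_,
    ?_⟩
  · have h1 := congrArg (MvPolynomial.eval (Pi.single i 1)) h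
    simp [MvPolynomial.smul_eval, hij.symm, hi] at h1
  · have hlow (k : Fin N) :
        lowerOp α (MvPolynomial.X k) = α k.castSucc • (1 : MvPolynomial (Fin N) ℝ) := by
      rw [lowerOp_apply, Finset.sum_eq_single k]
      · simp
      · intro n _ hn
        simp [MvPolynomial.pderiv_X, hn.symm]
      · simp
    have heul (k : Fin N) : eulerOp (MvPolynomial.X k : MvPolynomial (Fin N) ℝ) =
        MvPolynomial.X k := by
      rw [eulerOp_of_isHomogeneous (MvPolynomial.isHomogeneous_X ℝ k), Nat.cast_one, one_smul]
    rw [polyOp_apply]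
    simp only [map_sub, map_smul, hlow, heul, smul_smul, inv_mul_cancel₀ hi, inv_mul_cancel₀ hj,
      sub_self, mul_zero, zero_sub, neg_smul]

theorem energy_eigenvector (hα : ∀ i, 0 < α i) {w : MvPolynomial (Fin N) ℝ} {c : ℝ}
    (hw : polyOp α w = -c • w) :
    preForm α (fun x => MvPolynomial.eval x w) (fun x => MvPolynomial.eval x w) =
      c * ‖polyLp hα w‖ ^ 2 := by
  have hwd := contDiff_eval w (n := 2)
  rw [preForm_eq_neg_inner hα hwd hwd, toLp_diffOp_eval hα, toLp_eval hα, hw, map_smul,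
      inner_smul_right, real_inner_self_eq_norm_sq, neg_mul, neg_neg]

theorem isFormApprox_const (hα : ∀ i, 0 < α i) {f : (Fin N → ℝ) → ℝ} (hf : ContDiff ℝ 2 f) :
    IsFormApprox α (fun _ => f) (fun x => f x) where
  contDiff _ := hf
  tendsto := by
    have h : eLpNorm (fun _ : Simplex N => (0 : ℝ)) 2 (dirichletMeasure α) = 0 := eLpNorm_zero
    simp only [TendstoL2, sub_self, h]
    exact tendsto_const_nhds
  cauchy := by
    have h := preForm_sub_self hα hf hf
    rw [two_mul, sub_add_cancel_left, neg_add_cancel] at h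
    simp only [h]
    exact tendsto_const_nhds

/-- A polynomial eigenvector of `-L` with eigenvalue `c` has energy `c ‖w‖²`. -/
theorem isFormValue_eigenvector (hα : ∀ i, 0 < α i) {w : MvPolynomial (Fin N) ℝ} {c : ℝ}
    (hw : polyOp α w = -c • w) :
    IsFormValue α (fun x => MvPolynomial.eval x.1 w) (c * ‖polyLp hα w‖ ^ 2) := by
  refine ⟨memLp_of_continuous hα (continuous_eval_simplex w), _,
    isFormApprox_const hα (f := fun x => MvPolynomial.eval x w) (contDiff_eval w), ?_⟩
  rw [energy_eigenvector hα hw]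
  exact tendsto_const_nhds

theorem integral_eigenvector (hα : ∀ i, 0 < α i) {w : MvPolynomial (Fin N) ℝ} {c : ℝ}
    (hc : c ≠ 0) (hw : polyOp α w = -c • w) :
    ∫ x : Simplex N, MvPolynomial.eval x.1 w ∂(dirichletMeasure α) = 0 := by
  rw [← inner_polyLp_one hα (memLp_of_continuous hα (continuous_eval_simplex w)),
    ← polyLp_apply hα, inner_polyLp_one_eq_zero hα hc hw]

theorem integral_eval_sq (hα : ∀ i, 0 < α i) (w : MvPolynomial (Fin N) ℝ) :
    ∫ x : Simplex N, MvPolynomial.eval x.1 w ^ 2 ∂(dirichletMeasure α) = ‖polyLp hα w‖ ^ 2 := by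
  rw [← real_inner_self_eq_norm_sq, inner_polyLp]
  simp only [sq]

theorem spectralGap_eq (hN : 2 ≤ N) (hα : ∀ i, 0 < α i) : spectralGap α = α (Fin.last N) := by
  refine IsLeast.csInf_eq ⟨?_, ?_⟩
  · obtain ⟨w, hw0, hw⟩ := exists_eigenvector_last hN hα
    have hn : ‖polyLp hα w‖ ≠ 0 :=
      norm_ne_zero_iff.2 ((map_ne_zero_iff _ (polyLp_injective hα)).2 hw0)
    have hw' : polyOp α (‖polyLp hα w‖⁻¹ • w) = -α (Fin.last N) • (‖polyLp hα w‖⁻¹ • w) := by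
      rw [map_smul, hw, smul_comm]
    have h1 : ‖polyLp hα (‖polyLp hα w‖⁻¹ • w)‖ ^ 2 = 1 := by
      rw [map_smul, norm_smul, norm_inv, norm_norm, inv_mul_cancel₀ hn, one_pow]
    have hv := isFormValue_eigenvector hα hw'
    rw [h1, mul_one] at hv
    exact ⟨_, hv, integral_eigenvector hα (hα _).ne' hw', by rw [integral_eval_sq hα, h1]⟩
  · rintro e ⟨u, hu, h0, h1⟩
    have h := poincare_of_isFormValue hα hu
    rw [h0, h1] at h
    linarith

theorem isLeast_poincare_constant (hN : 2 ≤ N) (hα : ∀ i, 0 < α i) :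
    IsLeast {C : ℝ | ∀ (u : Simplex N → ℝ) (e : ℝ), IsFormValue α u e →
        ∫ x, u x ∂(dirichletMeasure α) = 0 →
        ∫ x, u x ^ 2 ∂(dirichletMeasure α) ≤ C * e} (1 / α (Fin.last N)) := by
  have h0 := hα (Fin.last N)
  refine ⟨fun u e hu hu0 => ?_, fun C hC => ?_⟩
  · have h := poincare_of_isFormValue hα hu
    rw [hu0, zero_pow two_ne_zero, sub_zero] at h
    rwa [one_div, inv_mul_eq_div, le_div_iff₀' h0]
  · obtain ⟨w, hw0, hw⟩ := exists_eigenvector_last hN hα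
    have hn : 0 < ‖polyLp hα w‖ ^ 2 :=
      pow_pos (norm_pos_iff.2 ((map_ne_zero_iff _ (polyLp_injective hα)).2 hw0)) 2
    have h := hC _ _ (isFormValue_eigenvector hα hw) (integral_eigenvector hα h0.ne' hw)
    rw [integral_eval_sq hα, ← mul_assoc] at h
    rw [div_le_iff₀ h0]
    exact le_of_mul_le_mul_right (by rwa [one_mul]) hn

/-! ### The transition kernels on polynomials -/

/-- A continuous function satisfying `m(t) = m₀ - c ∫₀ᵗ m` for `t ≥ 0` is `m₀ exp(-c t)`. -/
theorem eq_exp_of_eq_integral {m : ℝ → ℝ} (hm : Continuous m) {m₀ c : ℝ}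
    (h : ∀ t, 0 ≤ t → m t = m₀ - c * ∫ s in (0 : ℝ)..t, m s) {t : ℝ} (ht : 0 ≤ t) :
    m t = Real.exp (-c * t) * m₀ := by
  have hF (s : ℝ) : HasDerivAt (fun s => m₀ - c * ∫ r in (0 : ℝ)..s, m r) (-(c * m s)) s :=
    ((hm.integral_hasStrictDerivAt 0 s).hasDerivAt.const_mul c).const_sub m₀
  have hE (s : ℝ) : HasDerivAt (fun s => Real.exp (c * s)) (Real.exp (c * s) * c) s := by
    simpa using ((hasDerivAt_id s).const_mul c).exp
  have hG (s : ℝ) := (hE s).mul (hF s)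
  have key := constant_of_has_deriv_right_zero (a := 0) (b := t)
    (fun s _ => (hG s).continuousAt.continuousWithinAt) (fun s hs => by
      have h1 := (hG s).hasDerivWithinAt (s := Set.Ici s)
      rwa [show Real.exp (c * s) * c * (m₀ - c * ∫ r in (0 : ℝ)..s, m r) +
        Real.exp (c * s) * -(c * m s) = 0 by rw [← h s hs.1]; ring] at h1) t ⟨ht, le_rfl⟩
  simp only [Pi.mul_apply, mul_zero, Real.exp_zero, one_mul, intervalIntegral.integral_same,
    sub_zero, ← h t ht] at key
  rw [← key, ← mul_assoc, ← Real.exp_add]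
  simp

theorem IsWeakSolution.measurable {x : Simplex N} {Ω : Type} [mΩ : MeasurableSpace Ω]
    {P : Measure Ω} {X : ℝ≥0 → Ω → Simplex N} (hX : IsWeakSolution α x P X) (t : ℝ≥0) :
    Measurable (X t) := by
  obtain ⟨ℱ, hℱ, -⟩ := hX.martingale
  exact (hℱ t).mono (ℱ.le t) le_rfl

theorem isMarkovKernel {κ : ℝ≥0 → Kernel (Simplex N) (Simplex N)}
    (hκ : IsDiffusionSemigroup α κ) (t : ℝ≥0) : IsMarkovKernel (κ t) := by
  refine ⟨fun x => ?_⟩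
  obtain ⟨Ω, _, P, X, hX, hlaw⟩ := hκ x
  have := hX.isProbabilityMeasure
  rw [hlaw]
  exact Measure.isProbabilityMeasure_map (hX.measurable t).aemeasurable

theorem exists_abs_le_of_continuous {h : Simplex N → ℝ} (hh : Continuous h) :
    ∃ C, ∀ x, ‖h x‖ ≤ C := by
  obtain ⟨C, hC⟩ := isCompact_univ.exists_bound_of_continuousOn hh.continuousOn
  exact ⟨C, fun x => hC x (Set.mem_univ x)⟩

/-- The kernels act on an eigenfunction of `L` by multiplication: the martingale problem gives an
integral equation for the mean of the eigenfunction along the solution. -/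
theorem act_eigenfunction {κ : ℝ≥0 → Kernel (Simplex N) (Simplex N)}
    (hκ : IsDiffusionSemigroup α κ) {f : (Fin N → ℝ) → ℝ} (hf : ContDiff ℝ 2 f) {c : ℝ}
    (hL : ∀ y : Simplex N, diffOp α f y = -c * f y) (t : ℝ≥0) (x : Simplex N) :
    act (κ t) (fun y => f y) x = Real.exp (-c * t) * f x := by
  obtain ⟨Ω, mΩ, P, X, hX, hlaw⟩ := hκ x
  have hP := hX.isProbabilityMeasure
  have hmeas := hX.measurable
  set F : Simplex N → ℝ := fun y => f y with hF
  have hFc : Continuous F := hf.continuous.comp continuous_subtype_val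
  obtain ⟨C, hC⟩ := exists_abs_le_of_continuous hFc
  have hact (s : ℝ≥0) : act (κ s) F x = ∫ ω, F (X s ω) ∂P := by
    rw [act, hlaw, integral_map (hmeas s).aemeasurable hFc.aestronglyMeasurable]
  set m : ℝ → ℝ := fun s => ∫ ω, F (X s.toNNReal ω) ∂P with hm
  have hmc : Continuous m := by
    refine continuous_of_dominated (bound := fun _ => C) (fun s => ?_) (fun s => ?_)
      (integrable_const C) ?_
    · exact (hFc.measurable.comp (hmeas _)).aestronglyMeasurable
    · exact Eventually.of_forall fun ω => hC _
    · exact Eventually.of_forall fun ω =>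
        hFc.comp ((hX.continuous_paths ω).comp continuous_real_toNNReal)
  have hint (s : ℝ≥0) : Integrable (fun ω => F (X s ω)) P :=
    Integrable.of_bound (hFc.measurable.comp (hmeas s)).aestronglyMeasurable C
      (Eventually.of_forall fun ω => hC _)
  have hjoint : Measurable (Function.uncurry fun (ω : Ω) (s : ℝ) => F (X s.toNNReal ω)) :=
    (measurable_uncurry_of_continuous_of_measurable (u := fun (s : ℝ) ω => F (X s.toNNReal ω))
      (fun ω => hFc.comp ((hX.continuous_paths ω).comp continuous_real_toNNReal))
      (fun s => hFc.measurable.comp (hmeas _))).comp measurable_swap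
  have hprod (s : ℝ) : Integrable (Function.uncurry fun (ω : Ω) (r : ℝ) => F (X r.toNNReal ω))
      (P.prod (volume.restrict (Set.Ioc 0 s))) :=
    Integrable.of_bound hjoint.aestronglyMeasurable C (Eventually.of_forall fun ω => hC _)
  have heq (s : ℝ) (hs : 0 ≤ s) : m s = f x - c * ∫ r in (0 : ℝ)..s, m r := by
    obtain ⟨ℱ, -, hmart⟩ := hX.martingale
    have h1 := (hmart f hf).2 0 s.toNNReal zero_le
    have h2 := integral_congr_ae h1
    rw [integral_condExp (ℱ.le 0)] at h2
    simp only [hL, Real.coe_toNNReal s hs, NNReal.coe_zero, intervalIntegral.integral_same,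
      sub_zero, intervalIntegral.integral_const_mul] at h2
    have h3 : ∫ ω, F (X 0 ω) ∂P = f x := by
      rw [integral_congr_ae (g := fun _ => F x) (hX.start.mono fun ω h => by simp only [h])]
      simp [hF]
    have h4 : ∫ ω, (∫ r in (0 : ℝ)..s, F (X r.toNNReal ω)) ∂P = ∫ r in (0 : ℝ)..s, m r := by
      simp only [intervalIntegral.integral_of_le hs]
      exact integral_integral_swap (hprod s)
    have h5 : Integrable (fun ω => ∫ r in (0 : ℝ)..s, F (X r.toNNReal ω)) P := by
      simp only [intervalIntegral.integral_of_le hs]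
      exact (hprod s).integral_prod_left
    rw [integral_sub (hint _) (h5.const_mul _), integral_const_mul, h4, h3] at h2
    linear_combination h2
  have hres := eq_exp_of_eq_integral hmc heq t.coe_nonneg
  rw [hact, ← hres]
  simp only [hm, Real.toNNReal_coe]

theorem act_eigenvector {κ : ℝ≥0 → Kernel (Simplex N) (Simplex N)}
    (hκ : IsDiffusionSemigroup α κ) {φ : MvPolynomial (Fin N) ℝ} {c : ℝ}
    (hφ : polyOp α φ = -c • φ) (t : ℝ≥0) (x : Simplex N) :
    act (κ t) (fun y => MvPolynomial.eval y.1 φ) x =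
      Real.exp (-c * t) * MvPolynomial.eval x.1 φ :=
  act_eigenfunction hκ (f := fun y => MvPolynomial.eval y φ) (contDiff_eval φ)
    (fun y => by rw [diffOp_eval, hφ, MvPolynomial.smul_eval]) t x

theorem act_sum_eigenvector {κ : ℝ≥0 → Kernel (Simplex N) (Simplex N)}
    (hκ : IsDiffusionSemigroup α κ) {n : ℕ} {φ : Fin n → MvPolynomial (Fin N) ℝ} {c : Fin n → ℝ}
    (hφ : ∀ i, polyOp α (φ i) = -c i • φ i) (t : ℝ≥0) (x : Simplex N) :
    act (κ t) (fun y => MvPolynomial.eval y.1 (∑ i, φ i)) x =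
      MvPolynomial.eval x.1 (∑ i, Real.exp (-c i * t) • φ i) := by
  have := isMarkovKernel hκ t
  simp only [act, map_sum, MvPolynomial.smul_eval]
  rw [integral_finsetSum]
  · exact Finset.sum_congr rfl fun i _ => act_eigenvector hκ (hφ i) t x
  · intro i _
    exact (continuous_eval_simplex (φ i)).integrable_of_hasCompactSupport
      (HasCompactSupport.of_compactSpace _)

/-- Finite measures on the simplex are determined by the integrals of polynomials. -/
theorem measure_ext_of_polynomial {μ ν : Measure (Simplex N)} [IsFiniteMeasure μ]
    [IsFiniteMeasure ν] (h : ∀ p : MvPolynomial (Fin N) ℝ,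
      ∫ x, MvPolynomial.eval x.1 p ∂μ = ∫ x, MvPolynomial.eval x.1 p ∂ν) : μ = ν := by
  have hcont (ρ : Measure (Simplex N)) [IsFiniteMeasure ρ] :
      Continuous fun f : C(Simplex N, ℝ) => ∫ x, f x ∂ρ := by
    refine (continuous_integral.comp (ContinuousMap.toLp 1 ρ ℝ).continuous).congr fun f => ?_
    exact integral_congr_ae (ContinuousMap.coeFn_toLp ρ f)
  have key (f : C(Simplex N, ℝ)) : ∫ x, f x ∂μ = ∫ x, f x ∂ν := by
    refine (denseRange_polyC N).induction_on f (isClosed_eq (hcont μ) (hcont ν)) fun p => ?_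
    simpa only [polyC_apply] using h p
  exact ext_of_forall_integral_eq_of_IsFiniteMeasure fun f => key f.toContinuousMap

/-- The Dirichlet distribution is invariant. -/
theorem bind_dirichletMeasure (hα : ∀ i, 0 < α i) {κ : ℝ≥0 → Kernel (Simplex N) (Simplex N)}
    (hκ : IsDiffusionSemigroup α κ) (t : ℝ≥0) :
    (dirichletMeasure α).bind (κ t) = dirichletMeasure α := by
  have := isMarkovKernel hκ t
  have hprob := isProbabilityMeasure_dirichletMeasure hα
  refine measure_ext_of_polynomial fun p => ?_
  rw [Measure.comp_eq_comp_const_apply,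
    Kernel.integral_comp ((continuous_eval_simplex p).integrable_of_hasCompactSupport
      (HasCompactSupport.of_compactSpace _))]
  obtain ⟨n, φ, c, rfl, hφ, -, hc⟩ := exists_eigenvector_decomposition hα p
  have hint (q : MvPolynomial (Fin N) ℝ) :
      Integrable (fun x : Simplex N => MvPolynomial.eval x.1 q) (dirichletMeasure α) :=
    integrable_of_continuous hα (continuous_eval_simplex q)
  have h1 : ∀ x, ∫ y, MvPolynomial.eval y.1 (∑ i, φ i) ∂(κ t x) = _ := act_sum_eigenvector hκ hφ t
  simp only [h1, Kernel.const_apply]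
  simp only [map_sum, MvPolynomial.smul_eval]
  rw [integral_finsetSum _ fun i _ => (hint _).const_mul _, integral_finsetSum _ fun i _ => hint _]
  refine Finset.sum_congr rfl fun i _ => ?_
  rw [integral_const_mul]
  rcases hc i with ⟨-, h⟩ | h
  · simp [h]
  · rw [integral_eigenvector hα ((hα _).trans_le h).ne' (hφ i), mul_zero]

/-! ### The semigroup in `L²` -/

section Invariant

variable {μ : Measure (Simplex N)} {K : Kernel (Simplex N) (Simplex N)}

theorem act_congr_ae (hK : μ.bind K = μ) {f g : Simplex N → ℝ} (h : f =ᵐ[μ] g) :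
    act K f =ᵐ[μ] act K g := by
  rw [← hK] at h
  filter_upwards [Measure.ae_ae_of_ae_bind K.aemeasurable h] with x hx
  exact integral_congr_ae hx

theorem ae_integrable_kernel (hK : μ.bind K = μ) {f : Simplex N → ℝ} (hf : Integrable f μ) :
    ∀ᵐ x ∂μ, Integrable f (K x) := by
  rw [← hK] at hf
  exact Measure.ae_integrable_of_integrable_comp hf

theorem aestronglyMeasurable_act (hK : μ.bind K = μ) {f : Simplex N → ℝ}
    (hf : AEStronglyMeasurable f μ) : AEStronglyMeasurable (act K f) μ :=
  (hf.stronglyMeasurable_mk.integral_kernel (κ := K)).aestronglyMeasurable.congr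
    (act_congr_ae hK hf.ae_eq_mk.symm)

/-- A Markov kernel is a contraction in `L²` of an invariant measure, by Jensen's inequality. -/
theorem eLpNorm_act_le [IsMarkovKernel K] (hK : μ.bind K = μ) {f : Simplex N → ℝ}
    (hf : AEStronglyMeasurable f μ) : eLpNorm (act K f) 2 μ ≤ eLpNorm f 2 μ := by
  set g := hf.mk f with hg
  have hgm : StronglyMeasurable g := hf.stronglyMeasurable_mk
  rw [eLpNorm_congr_ae hf.ae_eq_mk, eLpNorm_congr_ae (act_congr_ae hK hf.ae_eq_mk), ← hg]
  have h2 : ((2 : ℝ≥0) : ℝ≥0∞) = 2 := rfl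
  rw [← ENNReal.rpow_le_rpow_iff (z := ((2 : ℝ≥0) : ℝ)) (by norm_num), ← h2,
    eLpNorm_nnreal_pow_eq_lintegral two_ne_zero, eLpNorm_nnreal_pow_eq_lintegral two_ne_zero]
  calc ∫⁻ x, ‖act K g x‖ₑ ^ ((2 : ℝ≥0) : ℝ) ∂μ
      ≤ ∫⁻ x, ∫⁻ y, ‖g y‖ₑ ^ ((2 : ℝ≥0) : ℝ) ∂(K x) ∂μ := by
        refine lintegral_mono fun x => ?_
        rw [← eLpNorm_nnreal_pow_eq_lintegral two_ne_zero]
        refine ENNReal.rpow_le_rpow ?_ (by norm_num)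
        refine (enorm_integral_le_lintegral_enorm _).trans ?_
        rw [← eLpNorm_one_eq_lintegral_enorm]
        exact eLpNorm_le_eLpNorm_of_exponent_le (by rw [h2]; norm_num)
          hgm.aestronglyMeasurable
    _ = ∫⁻ y, ‖g y‖ₑ ^ ((2 : ℝ≥0) : ℝ) ∂μ := by
        conv_rhs => rw [← hK]
        rw [Measure.lintegral_bind K.aemeasurable (by fun_prop)]

theorem memLp_act [IsMarkovKernel K] (hK : μ.bind K = μ) {f : Simplex N → ℝ} (hf : MemLp f 2 μ) :
    MemLp (act K f) 2 μ :=
  ⟨aestronglyMeasurable_act hK hf.1, (eLpNorm_act_le hK hf.1).trans_lt hf.2⟩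

/-- The operator on `L²(μ)` given by a Markov kernel for which `μ` is invariant. -/
def actLp [IsProbabilityMeasure μ] [IsMarkovKernel K] (hK : μ.bind K = μ) :
    Lp ℝ 2 μ →L[ℝ] Lp ℝ 2 μ :=
  LinearMap.mkContinuous
    { toFun := fun u => (memLp_act hK (Lp.memLp u)).toLp _
      map_add' := fun u v => by
        rw [← MemLp.toLp_add]
        refine MemLp.toLp_congr _ _ ?_
        filter_upwards [act_congr_ae hK (Lp.coeFn_add u v),
          ae_integrable_kernel hK ((Lp.memLp u).integrable one_le_two),
          ae_integrable_kernel hK ((Lp.memLp v).integrable one_le_two)] with x h1 h2 h3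
        rw [h1, Pi.add_apply]
        exact integral_add h2 h3
      map_smul' := fun c u => by
        rw [RingHom.id_apply, ← MemLp.toLp_const_smul]
        refine MemLp.toLp_congr _ _ ?_
        filter_upwards [act_congr_ae hK (Lp.coeFn_smul c u)] with x h1
        rw [h1, Pi.smul_apply]
        exact integral_smul c _ }
    1 fun u => by
      rw [one_mul]
      change ‖(memLp_act hK (Lp.memLp u)).toLp _‖ ≤ _
      rw [Lp.norm_toLp, Lp.norm_def]
      exact ENNReal.toReal_mono (Lp.memLp u).2.ne (eLpNorm_act_le hK (Lp.memLp u).1)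

theorem actLp_toLp [IsProbabilityMeasure μ] [IsMarkovKernel K] (hK : μ.bind K = μ)
    {f : Simplex N → ℝ} (hf : MemLp f 2 μ) :
    actLp hK (hf.toLp f) = (memLp_act hK hf).toLp _ :=
  MemLp.toLp_congr (memLp_act hK (Lp.memLp (hf.toLp f))) (memLp_act hK hf)
    (act_congr_ae hK hf.coeFn_toLp)

end Invariant

section Semigroup

variable {κ : ℝ≥0 → Kernel (Simplex N) (Simplex N)}

/-- The semigroup `P_t` on `L²` of the Dirichlet distribution. -/
def semigroupLp (hα : ∀ i, 0 < α i) (hκ : IsDiffusionSemigroup α κ) (t : ℝ≥0) :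
    Lp ℝ 2 (dirichletMeasure α) →L[ℝ] Lp ℝ 2 (dirichletMeasure α) :=
  have := isMarkovKernel hκ t
  have := isProbabilityMeasure_dirichletMeasure hα
  actLp (bind_dirichletMeasure hα hκ t)

theorem memLp_act_diffusion (hα : ∀ i, 0 < α i) (hκ : IsDiffusionSemigroup α κ) (t : ℝ≥0)
    {f : Simplex N → ℝ} (hf : MemLp f 2 (dirichletMeasure α)) :
    MemLp (act (κ t) f) 2 (dirichletMeasure α) :=
  have := isMarkovKernel hκ t
  memLp_act (bind_dirichletMeasure hα hκ t) hf

theorem semigroupLp_toLp (hα : ∀ i, 0 < α i) (hκ : IsDiffusionSemigroup α κ) (t : ℝ≥0)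
    {f : Simplex N → ℝ} (hf : MemLp f 2 (dirichletMeasure α)) :
    semigroupLp hα hκ t (hf.toLp f) = (memLp_act_diffusion hα hκ t hf).toLp _ :=
  have := isMarkovKernel hκ t
  have := isProbabilityMeasure_dirichletMeasure hα
  actLp_toLp (bind_dirichletMeasure hα hκ t) hf

theorem semigroupLp_eigenvector (hα : ∀ i, 0 < α i) (hκ : IsDiffusionSemigroup α κ) (t : ℝ≥0)
    {φ : MvPolynomial (Fin N) ℝ} {c : ℝ} (hφ : polyOp α φ = -c • φ) :
    semigroupLp hα hκ t (polyLp hα φ) = Real.exp (-c * t) • polyLp hα φ := by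
  rw [← map_smul, polyLp_apply, semigroupLp_toLp, polyLp_apply]
  refine MemLp.toLp_congr _ _ (Eventually.of_forall fun x => ?_)
  simp only [act_eigenvector hκ hφ t x, MvPolynomial.smul_eval]

theorem semigroupLp_one (hα : ∀ i, 0 < α i) (hκ : IsDiffusionSemigroup α κ) (t : ℝ≥0) :
    semigroupLp hα hκ t (polyLp hα 1) = polyLp hα 1 := by
  rw [semigroupLp_eigenvector hα hκ t (c := 0)
    (by simp [polyOp_apply, lowerOp_apply, eulerOp_apply])]
  simp

/-- `P_t` is symmetric: eigenvectors with different eigenvalues are orthogonal. -/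
theorem inner_semigroupLp (hα : ∀ i, 0 < α i) (hκ : IsDiffusionSemigroup α κ) (t : ℝ≥0)
    (u v : Lp ℝ 2 (dirichletMeasure α)) :
    inner ℝ (semigroupLp hα hκ t u) v = inner ℝ u (semigroupLp hα hκ t v) := by
  have hc := (semigroupLp hα hκ t).continuous
  refine (denseRange_polyLp hα).induction_on₂ (p := fun u v =>
    inner ℝ (semigroupLp hα hκ t u) v = inner ℝ u (semigroupLp hα hκ t v))
    (isClosed_eq (by fun_prop) (by fun_prop)) (fun p q => ?_) u v
  obtain ⟨n, φ, c, rfl, hφ, -, -⟩ := exists_eigenvector_decomposition hα p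
  obtain ⟨n', ψ, d, rfl, hψ, -, -⟩ := exists_eigenvector_decomposition hα q
  simp only [map_sum, sum_inner, inner_sum]
  refine Finset.sum_congr rfl fun i _ => Finset.sum_congr rfl fun j _ => ?_
  rw [semigroupLp_eigenvector hα hκ t (hφ j), semigroupLp_eigenvector hα hκ t (hψ i),
    inner_smul_left, inner_smul_right]
  have h := inner_polyLp_polyOp hα (φ j) (ψ i)
  rw [hφ, hψ, map_smul, map_smul, inner_smul_left, inner_smul_right] at h
  simp only [conj_trivial] at h ⊢
  by_cases hcd : c j = d i
  · rw [hcd]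
  · have h0 : inner ℝ (polyLp hα (φ j)) (polyLp hα (ψ i)) = 0 := by
      have h1 : (c j - d i) * inner ℝ (polyLp hα (φ j)) (polyLp hα (ψ i)) = 0 := by
        linear_combination -h
      exact (mul_eq_zero.1 h1).resolve_left (sub_ne_zero.2 hcd)
    rw [h0, mul_zero, mul_zero]

theorem norm_sq_sum_smul_of_orthogonal {E : Type*} [NormedAddCommGroup E] [InnerProductSpace ℝ E]
    {ι : Type*} [Fintype ι] {v : ι → E} (hv : ∀ i j, i ≠ j → inner ℝ (v i) (v j) = 0)
    (a : ι → ℝ) : ‖∑ i, a i • v i‖ ^ 2 = ∑ i, a i ^ 2 * ‖v i‖ ^ 2 := by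
  rw [← real_inner_self_eq_norm_sq, inner_sum_sum_of_orthogonal hv]
  simp only [sq]

/-- Exponential convergence to equilibrium in `L²`. -/
theorem norm_semigroupLp_sub_le (hα : ∀ i, 0 < α i) (hκ : IsDiffusionSemigroup α κ) (t : ℝ≥0)
    (u : Lp ℝ 2 (dirichletMeasure α)) :
    ‖semigroupLp hα hκ t u - inner ℝ (polyLp hα 1) u • polyLp hα 1‖ ≤
      Real.exp (-(α (Fin.last N) * t)) * ‖u‖ := by
  refine (denseRange_polyLp hα).induction_on (p := fun u =>
    ‖semigroupLp hα hκ t u - inner ℝ (polyLp hα 1) u • polyLp hα 1‖ ≤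
      Real.exp (-(α (Fin.last N) * t)) * ‖u‖) u
    (isClosed_le (by fun_prop) (by fun_prop)) fun p => ?_
  obtain ⟨a, n, φ, c, rfl, hφ, horth, hc, h1⟩ := exists_const_add_eigenvector_decomposition hα p
  have hsum : polyLp hα (∑ i, φ i) = ∑ i, (1 : ℝ) • polyLp hα (φ i) := by simp
  have h3 : inner ℝ (polyLp hα 1) (polyLp hα (∑ i, φ i)) = 0 := by
    rw [map_sum, inner_sum]; exact Finset.sum_eq_zero fun i _ => h1 i
  have hn : inner ℝ (polyLp hα 1) (polyLp hα 1) = 1 := by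
    rw [real_inner_self_eq_norm_sq, norm_polyLp_one, one_pow]
  have hleft : semigroupLp hα hκ t (polyLp hα (a • 1 + ∑ i, φ i)) -
      inner ℝ (polyLp hα 1) (polyLp hα (a • 1 + ∑ i, φ i)) • polyLp hα 1 =
      ∑ i, Real.exp (-c i * t) • polyLp hα (φ i) := by
    rw [map_add, inner_add_right, h3, map_smul, inner_smul_right, hn, map_add, map_smul,
      semigroupLp_one, mul_one, add_zero, add_sub_cancel_left, map_sum, map_sum]
    exact Finset.sum_congr rfl fun i _ => semigroupLp_eigenvector hα hκ t (hφ i)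
  have hright : ‖polyLp hα (∑ i, φ i)‖ ≤ ‖polyLp hα (a • 1 + ∑ i, φ i)‖ := by
    rw [map_add, ← sq_le_sq₀ (norm_nonneg _) (norm_nonneg _), ← real_inner_self_eq_norm_sq,
      ← real_inner_self_eq_norm_sq, inner_add_add_self, map_smul, inner_smul_left,
      inner_smul_right, inner_smul_left, inner_smul_right,
      real_inner_comm (polyLp hα 1) (polyLp hα (∑ i, φ i)), h3, hn]
    simp only [conj_trivial]
    nlinarith [mul_self_nonneg a]
  rw [hleft]
  refine le_trans ?_ (mul_le_mul_of_nonneg_left hright (Real.exp_nonneg _))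
  rw [← sq_le_sq₀ (norm_nonneg _) (by positivity), mul_pow, hsum,
    norm_sq_sum_smul_of_orthogonal horth, norm_sq_sum_smul_of_orthogonal horth, Finset.mul_sum]
  refine Finset.sum_le_sum fun i _ => ?_
  rw [one_pow, one_mul]
  refine mul_le_mul_of_nonneg_right ?_ (sq_nonneg _)
  refine pow_le_pow_left₀ (Real.exp_nonneg _) (Real.exp_le_exp.2 ?_) 2
  rw [neg_mul, neg_le_neg_iff]
  exact mul_le_mul_of_nonneg_right (hc i) t.coe_nonneg

/-! ### The generator in `L²` -/

theorem tendsto_exp_difference_quotient (c : ℝ) :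
    Tendsto (fun t : ℝ≥0 => (t : ℝ)⁻¹ * (Real.exp (-c * t) - 1)) (𝓝[>] 0) (𝓝 (-c)) := by
  have h : HasDerivAt (fun s : ℝ => Real.exp (-c * s)) (-c) 0 := by
    simpa using ((hasDerivAt_id (0 : ℝ)).const_mul (-c)).exp
  have h1 := (hasDerivAt_iff_tendsto_slope.1 h)
  have h2 : Tendsto (fun t : ℝ≥0 => (t : ℝ)) (𝓝[>] 0) (𝓝[≠] 0) := by
    refine tendsto_nhdsWithin_iff.2 ⟨?_, ?_⟩
    · exact (NNReal.continuous_coe.tendsto' 0 0 rfl).mono_left nhdsWithin_le_nhds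
    · filter_upwards [self_mem_nhdsWithin] with t ht
      exact (NNReal.coe_pos.2 ht).ne'
  refine (h1.comp h2).congr fun t => ?_
  simp [slope_def_field, div_eq_inv_mul]

/-- The difference quotient `(P_t u - u) / t`. -/
def diffQuotient (hα : ∀ i, 0 < α i) (hκ : IsDiffusionSemigroup α κ) (t : ℝ≥0)
    (u : Lp ℝ 2 (dirichletMeasure α)) : Lp ℝ 2 (dirichletMeasure α) :=
  (t : ℝ)⁻¹ • (semigroupLp hα hκ t u - u)

theorem diffQuotient_sub (hα : ∀ i, 0 < α i) (hκ : IsDiffusionSemigroup α κ) (t : ℝ≥0)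
    (u v : Lp ℝ 2 (dirichletMeasure α)) :
    diffQuotient hα hκ t (u - v) = diffQuotient hα hκ t u - diffQuotient hα hκ t v := by
  simp only [diffQuotient, map_sub, smul_sub]
  abel

theorem continuous_diffQuotient (hα : ∀ i, 0 < α i) (hκ : IsDiffusionSemigroup α κ) (t : ℝ≥0) :
    Continuous (diffQuotient hα hκ t) := by
  unfold diffQuotient; fun_prop

theorem inner_diffQuotient (hα : ∀ i, 0 < α i) (hκ : IsDiffusionSemigroup α κ) (t : ℝ≥0)
    (u v : Lp ℝ 2 (dirichletMeasure α)) :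
    inner ℝ (diffQuotient hα hκ t u) v = inner ℝ u (diffQuotient hα hκ t v) := by
  rw [diffQuotient, diffQuotient, inner_smul_left, inner_smul_right, inner_sub_left,
    inner_sub_right, inner_semigroupLp, conj_trivial]

theorem diffQuotient_sum_eigenvector (hα : ∀ i, 0 < α i) (hκ : IsDiffusionSemigroup α κ) (t : ℝ≥0)
    {n : ℕ} {φ : Fin n → MvPolynomial (Fin N) ℝ} {c : Fin n → ℝ}
    (hφ : ∀ i, polyOp α (φ i) = -c i • φ i) :
    diffQuotient hα hκ t (polyLp hα (∑ i, φ i)) =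
      ∑ i, ((t : ℝ)⁻¹ * (Real.exp (-c i * t) - 1)) • polyLp hα (φ i) := by
  rw [diffQuotient, map_sum, map_sum, ← Finset.sum_sub_distrib, Finset.smul_sum]
  refine Finset.sum_congr rfl fun i _ => ?_
  rw [semigroupLp_eigenvector hα hκ t (hφ i), mul_smul, sub_smul, one_smul]

theorem polyLp_polyOp_sum_eigenvector (hα : ∀ i, 0 < α i)
    {n : ℕ} {φ : Fin n → MvPolynomial (Fin N) ℝ} {c : Fin n → ℝ}
    (hφ : ∀ i, polyOp α (φ i) = -c i • φ i) :
    polyLp hα (polyOp α (∑ i, φ i)) = ∑ i, -c i • polyLp hα (φ i) := by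
  rw [map_sum, map_sum]
  exact Finset.sum_congr rfl fun i _ => by rw [hφ, map_smul]

theorem tendsto_diffQuotient_polyLp (hα : ∀ i, 0 < α i) (hκ : IsDiffusionSemigroup α κ)
    (p : MvPolynomial (Fin N) ℝ) :
    Tendsto (fun t => diffQuotient hα hκ t (polyLp hα p)) (𝓝[>] 0)
      (𝓝 (polyLp hα (polyOp α p))) := by
  obtain ⟨n, φ, c, rfl, hφ, -, -⟩ := exists_eigenvector_decomposition hα p
  simp only [diffQuotient_sum_eigenvector hα hκ _ hφ, polyLp_polyOp_sum_eigenvector hα hφ]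
  exact tendsto_finsetSum _ fun i _ => (tendsto_exp_difference_quotient (c i)).smul_const _

/-- The difference quotient of a polynomial is bounded by its image under `L`, because
`0 ≤ 1 - exp(-c t) ≤ c t`. -/
theorem norm_diffQuotient_polyLp_le (hα : ∀ i, 0 < α i) (hκ : IsDiffusionSemigroup α κ) (t : ℝ≥0)
    (p : MvPolynomial (Fin N) ℝ) :
    ‖diffQuotient hα hκ t (polyLp hα p)‖ ≤ ‖polyLp hα (polyOp α p)‖ := by
  obtain ⟨n, φ, c, rfl, hφ, horth, hc⟩ := exists_eigenvector_decomposition hα p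
  rw [diffQuotient_sum_eigenvector hα hκ _ hφ, polyLp_polyOp_sum_eigenvector hα hφ,
    ← sq_le_sq₀ (norm_nonneg _) (norm_nonneg _), norm_sq_sum_smul_of_orthogonal horth,
    norm_sq_sum_smul_of_orthogonal horth]
  refine Finset.sum_le_sum fun i _ => mul_le_mul_of_nonneg_right ?_ (sq_nonneg _)
  have hc0 : 0 ≤ c i := by
    rcases hc i with ⟨-, h⟩ | h
    · exact h.ge
    · exact (hα _).le.trans h
  rcases eq_or_ne t 0 with rfl | ht
  · simp [sq_nonneg]
  have ht0 : 0 < (t : ℝ) := NNReal.coe_pos.2 (pos_iff_ne_zero.2 ht)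
  have h1 : Real.exp (-c i * t) ≤ 1 := by
    rw [Real.exp_le_one_iff]; nlinarith
  have h2 : -c i * t + 1 ≤ Real.exp (-c i * t) := Real.add_one_le_exp _
  rw [sq_le_sq, abs_neg, abs_mul, abs_inv, abs_of_pos ht0, abs_of_nonneg hc0, inv_mul_le_iff₀ ht0,
    abs_le]
  constructor <;> nlinarith

/-- If `⟨v, q⟩ = ⟨u, L q⟩` for all polynomials `q`, then `(u, v)` is the limit of `(p_k, L p_k)`,
where `p_k` is the orthogonal projection of `u` to the polynomials of degree at most `k`: then
`L p_k` is the corresponding projection of `v`. -/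
theorem exists_polynomial_approximation_of_weak (hα : ∀ i, 0 < α i)
    {u v : Lp ℝ 2 (dirichletMeasure α)}
    (h : ∀ q, inner ℝ v (polyLp hα q) = inner ℝ u (polyLp hα (polyOp α q))) :
    ∃ p : ℕ → MvPolynomial (Fin N) ℝ, Tendsto (fun k => polyLp hα (p k)) atTop (𝓝 u) ∧
      Tendsto (fun k => polyLp hα (polyOp α (p k))) atTop (𝓝 v) := by
  obtain ⟨p, hp, hpd, hpu⟩ := exists_polynomial_projections hα u
  obtain ⟨r, hr, hrd, hrv⟩ := exists_polynomial_projections hα v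
  refine ⟨p, hp, hr.congr fun k => ?_⟩
  have hdeg : (r k - polyOp α (p k)).totalDegree ≤ k :=
    (MvPolynomial.totalDegree_sub _ _).trans (max_le (hrd k) (totalDegree_polyOp_le α (hpd k)))
  rw [← sub_eq_zero, ← map_sub, ← inner_self_eq_zero (𝕜 := ℝ)]
  nth_rewrite 1 [map_sub]
  rw [inner_sub_left, hrv k _ hdeg, h, inner_polyLp_polyOp, hpu k _ (totalDegree_polyOp_le α hdeg),
    sub_self]

/-- The difference quotients of `u` differ from those of its approximants `p_k` by at most
`‖v - L p_k‖`, uniformly in `t`, so the limit `t → 0` carries over from polynomials. -/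
theorem tendsto_diffQuotient_of_weak (hα : ∀ i, 0 < α i) (hκ : IsDiffusionSemigroup α κ)
    {u v : Lp ℝ 2 (dirichletMeasure α)}
    (h : ∀ q, inner ℝ v (polyLp hα q) = inner ℝ u (polyLp hα (polyOp α q))) :
    Tendsto (fun t => diffQuotient hα hκ t u) (𝓝[>] 0) (𝓝 v) := by
  obtain ⟨p, hp, hLp⟩ := exists_polynomial_approximation_of_weak hα h
  -- apply the bound for polynomials to `p_l - p_k` and let `l → ∞`
  have hbound (t : ℝ≥0) (k : ℕ) :
      ‖diffQuotient hα hκ t u - diffQuotient hα hκ t (polyLp hα (p k))‖ ≤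
        ‖v - polyLp hα (polyOp α (p k))‖ := by
    refine le_of_tendsto_of_tendsto' ((((continuous_diffQuotient hα hκ t).tendsto u).comp hp).sub
      tendsto_const_nhds).norm (hLp.sub tendsto_const_nhds).norm fun l => ?_
    rw [Function.comp_apply, ← diffQuotient_sub, ← map_sub, ← map_sub, ← map_sub]
    exact norm_diffQuotient_polyLp_le hα hκ t _
  rw [Metric.tendsto_nhds]
  intro ε hε
  obtain ⟨k, hk⟩ := (Metric.tendsto_atTop.1 hLp (ε / 3) (by positivity)).imp fun k hk => hk k le_rfl
  filter_upwards [Metric.tendsto_nhds.1 (tendsto_diffQuotient_polyLp hα hκ (p k)) (ε / 3)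
    (by positivity)] with t ht
  have h1 := hbound t k
  rw [← dist_eq_norm, ← dist_eq_norm, dist_comm v] at h1
  calc dist (diffQuotient hα hκ t u) v
      ≤ dist (diffQuotient hα hκ t u) (diffQuotient hα hκ t (polyLp hα (p k))) +
        dist (diffQuotient hα hκ t (polyLp hα (p k))) (polyLp hα (polyOp α (p k))) +
        dist (polyLp hα (polyOp α (p k))) v := dist_triangle4 _ _ _ _
    _ < ε := by linarith

theorem isGeneratorValue_iff_tendsto (hα : ∀ i, 0 < α i) (hκ : IsDiffusionSemigroup α κ)
    {u v : Simplex N → ℝ} (hu : MemLp u 2 (dirichletMeasure α))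
    (hv : MemLp v 2 (dirichletMeasure α)) :
    IsGeneratorValue α κ u v ↔
      Tendsto (fun t => diffQuotient hα hκ t (hu.toLp u)) (𝓝[>] 0) (𝓝 (hv.toLp v)) := by
  have h1 (t : ℝ≥0) : MemLp (fun x => (t : ℝ)⁻¹ * (act (κ t) u x - u x)) 2 (dirichletMeasure α) :=
    ((memLp_act_diffusion hα hκ t hu).sub hu).const_mul _
  rw [IsGeneratorValue]
  simp only [div_eq_inv_mul]
  rw [tendstoL2_iff h1 hv]
  refine tendsto_congr fun t => ?_
  rw [diffQuotient, semigroupLp_toLp, ← MemLp.toLp_sub, ← MemLp.toLp_const_smul]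
  rfl

/-- The generator of the semigroup in `L²` is the closure of `L` on `C²`; both are the operator
`u ↦ v` defined by `⟨v, q⟩ = ⟨u, L q⟩` for all polynomials `q`. -/
theorem isGeneratorValue_iff_isClosureValue (hα : ∀ i, 0 < α i) (hκ : IsDiffusionSemigroup α κ)
    {u v : Simplex N → ℝ} (hu : MemLp u 2 (dirichletMeasure α))
    (hv : MemLp v 2 (dirichletMeasure α)) :
    IsGeneratorValue α κ u v ↔ IsClosureValue α u v := by
  rw [isGeneratorValue_iff_tendsto hα hκ hu hv]
  constructor
  · intro h
    obtain ⟨p, hp, hLp⟩ := exists_polynomial_approximation_of_weak hα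
      (u := hu.toLp u) (v := hv.toLp v) fun q => by
        have h1 : Tendsto (fun t => inner ℝ (diffQuotient hα hκ t (hu.toLp u)) (polyLp hα q))
          (𝓝[>] 0) (𝓝 (inner ℝ (hv.toLp v) (polyLp hα q))) := h.inner tendsto_const_nhds
        simp only [inner_diffQuotient] at h1
        exact tendsto_nhds_unique h1
          (tendsto_const_nhds.inner (tendsto_diffQuotient_polyLp hα hκ q))
    refine ⟨fun k x => MvPolynomial.eval x (p k), fun k => contDiff_eval (p k), ?_, ?_⟩
    · exact (tendstoL2_iff
        (fun k => memLp_of_continuous hα (continuous_eval_simplex (p k))) hu).2 hp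
    · simp only [diffOp_eval]
      exact (tendstoL2_iff (fun k => memLp_of_continuous hα
        (continuous_eval_simplex (polyOp α (p k)))) hv).2 hLp
  · rintro ⟨f, hf, hfu, hfv⟩
    rw [tendstoL2_iff (fun k => memLp_of_contDiff hα (hf k)) hu] at hfu
    rw [tendstoL2_iff (fun k => memLp_diffOp hα (hf k)) hv] at hfv
    refine tendsto_diffQuotient_of_weak hα hκ fun q => ?_
    refine tendsto_nhds_unique (hfv.inner (𝕜 := ℝ) tendsto_const_nhds)
      ((hfu.inner (𝕜 := ℝ) tendsto_const_nhds).congr fun k => ?_)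
    have h := integral_mul_diffOp_comm hα (hf k) (contDiff_eval q)
    rw [← toLp_diffOp_eval hα, inner_toLp, h, ← toLp_eval hα, inner_toLp]
    simp only [mul_comm]

end Semigroup

end DirichletDiffusion

end

theorem theorem1p1 (N : ℕ) (hN : 2 ≤ N) (α : Fin (N + 1) → ℝ) (hα : ∀ i, 0 < α i) :
    IsProbabilityMeasure (dirichletMeasure α) ∧
    -- symmetry of the operator `L` on `C²`, and its form
    (∀ f g : (Fin N → ℝ) → ℝ, ContDiff ℝ 2 f → ContDiff ℝ 2 g →
      ∫ x : Simplex N, f x * diffOp α g x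
          ∂(dirichletMeasure α) =
        ∫ x : Simplex N, g x * diffOp α f x
          ∂(dirichletMeasure α) ∧
      -∫ x : Simplex N, f x * diffOp α g x
          ∂(dirichletMeasure α) = preForm α f g) ∧
    FormClosable α ∧
    -- the spectral gap
    spectralGap α = α (Fin.last N) ∧
    -- the Poincaré inequality on the domain of the closed form, with sharp constant
    IsLeast {C : ℝ | ∀ (u : Simplex N → ℝ) (e : ℝ),
        IsFormValue α u e →
        ∫ x, u x ∂(dirichletMeasure α) = 0 →
        ∫ x, u x ^ 2 ∂(dirichletMeasure α) ≤ C * e}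
      (1 / α (Fin.last N)) ∧
    -- the diffusion semigroup
    ∀ κ : ℝ≥0 → Kernel (Simplex N) (Simplex N),
      IsDiffusionSemigroup α κ →
      -- it acts on `L²`
      (∀ (t : ℝ≥0) (f : Simplex N → ℝ),
        MemLp f 2 (dirichletMeasure α) →
        (∀ᵐ x ∂(dirichletMeasure α), Integrable f (κ t x)) ∧
        MemLp (act (κ t) f) 2 (dirichletMeasure α)) ∧
      -- it is symmetric
      (∀ (t : ℝ≥0) (f g : Simplex N → ℝ),
        MemLp f 2 (dirichletMeasure α) →
        MemLp g 2 (dirichletMeasure α) →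
        ∫ x, f x * act (κ t) g x ∂(dirichletMeasure α) =
          ∫ x, g x * act (κ t) f x
            ∂(dirichletMeasure α)) ∧
      -- its generator is the closure of `L` on `C²`
      (∀ u v : Simplex N → ℝ,
        MemLp u 2 (dirichletMeasure α) →
        MemLp v 2 (dirichletMeasure α) →
        (IsGeneratorValue α κ u v ↔
          IsClosureValue α u v)) ∧
      -- exponential convergence in operator norm
      (∀ (t : ℝ≥0) (f : Simplex N → ℝ),
        MemLp f 2 (dirichletMeasure α) →
        eLpNorm (fun x => act (κ t) f x -
            ∫ y, f y ∂(dirichletMeasure α)) 2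
            (dirichletMeasure α) ≤
          ENNReal.ofReal (Real.exp (-(α (Fin.last N) * t))) *
            eLpNorm f 2 (dirichletMeasure α)) := by
  have hprob := isProbabilityMeasure_dirichletMeasure hα
  refine ⟨hprob, fun f g hf hg => ⟨integral_mul_diffOp_comm hα hf hg,
    neg_integral_mul_diffOp hα hf hg⟩, formClosable hα, spectralGap_eq hN hα,
    isLeast_poincare_constant hN hα, fun κ hκ => ⟨fun t f hf => ⟨?_, ?_⟩, fun t f g hf hg => ?_,
    fun u v hu hv => isGeneratorValue_iff_isClosureValue hα hκ hu hv, fun t f hf => ?_⟩⟩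
  · exact ae_integrable_kernel (bind_dirichletMeasure hα hκ t) (hf.integrable one_le_two)
  · exact memLp_act_diffusion hα hκ t hf
  · have h := inner_semigroupLp hα hκ t (hg.toLp g) (hf.toLp f)
    rw [semigroupLp_toLp, semigroupLp_toLp, inner_toLp, inner_toLp] at h
    rw [← h]
    simp only [mul_comm]
  · have h := norm_semigroupLp_sub_le hα hκ t (hf.toLp f)
    have hact := memLp_act_diffusion hα hκ t hf
    have hsub : MemLp (fun x => act (κ t) f x - ∫ y, f y ∂(dirichletMeasure α)) 2
        (dirichletMeasure α) := hact.sub (memLp_const _)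
    have heq : semigroupLp hα hκ t (hf.toLp f) - inner ℝ (polyLp hα 1) (hf.toLp f) • polyLp hα 1 =
        hsub.toLp _ := by
      rw [semigroupLp_toLp, inner_polyLp_one, polyLp_apply, ← MemLp.toLp_const_smul,
        ← MemLp.toLp_sub]
      refine MemLp.toLp_congr _ _ (Eventually.of_forall fun x => ?_)
      simp
    rw [heq, Lp.norm_toLp, Lp.norm_toLp] at h
    rw [← ENNReal.ofReal_toReal hsub.2.ne, ← ENNReal.ofReal_toReal hf.2.ne,
      ← ENNReal.ofReal_mul (Real.exp_nonneg _)]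
    exact ENNReal.ofReal_le_ofReal h
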